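/- \textbf{Theorem ($L^2$ rate of convergence).} Fix $d$. For each $n$ let $(y_i,x_i)$, $i=1,\dots,n$ (depending on $n$) be i.i.d. random vectors with $$y_i=g(x_i)+\epsilon_i,\qquad E[\epsilon_i\mid x_i]=0,\qquad x_i\in\mathcal X\subseteq\mathbb R^d,\qquad x_i\sim F,$$ where $g$ belongs to a class $\mathcal G$ of measurable functions, and let $p=(p_1,\dots,p_k)':\mathbb R^d\to\mathbb R^k$ be measurable with $\xi_k:=\sup_{x\in\mathcal X}\|p(x)\|<\infty$; the joint law, $g$, $F$, $\mathcal X$, $\mathcal G$, $k$ and $p$ may all change with $n$. For $f\in\mathcal G$ let $\beta_f$ minimize $b\mapsto E[(f(x_i)-p(x_i)'b)^2]$ over $\mathbb R^k$ and put $r_f:=f-p'\beta_f$. Write $\|f\|_{F,2}:=(\int f^2\,dF)^{1/2}$. Assume: (i) there are constants $0<\underline\lambda\le\overline\lambda<\infty$ not depending on $n$ such that all eigenvalues of $Q:=E[p(x_i)p(x_i)']$ lie in $[\underline\lambda,\overline\lambda]$; (ii) for each $n$ there are finite constants $c_k\ge 0$ and $\ell_k$ (which may depend on $n$) such that $\|r_f\|_{F,2}\le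 c_k$ and $\sup_{x\in\mathcal X}|r_f(x)|\le\ell_kc_k$ for all $f\in\mathcal G$; (iii) $\xi_k^2\log n/n\to0$ as $n\to\infty$; (iv) $E[\epsilon_i^2\mid x_i]\le C$ almost surely, for a constant $C$ not depending on $n$. Let $\beta$ be the minimizer of $b\mapsto E[(y_i-p(x_i)'b)^2]$, let $\widehat\beta$ be any minimizer of $b\mapsto\frac1n\sum_{i=1}^n(y_i-p(x_i)'b)^2$, and let $\widehat g:=p'\widehat\beta$. Then, as $n\to\infty$: if $c_k\to0$ (the correctly specified case), then $$\|\widehat g-g\|_{F,2}=O_P\bigl(\sqrt{k/n}+c_k\bigr);$$ if $c_k\not\to0$ (the misspecified case), then $$\|\widehat g-p'\beta\|_{F,2}=O_P\Bigl(\sqrt{k/n}+\min\bigl\{\ell_kc_k\sqrt{k/n},\ \xi_kc_k/\sqrt n\bigr\}\Bigr).$$ -/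

import Mathlib

open MeasureTheory ProbabilityTheory Filter Topology
open scoped ENNReal

/-- The linear form `x ↦ p(x)'b` in the approximating functions `p = (p₁, …, p_k)'`. -/
noncomputable def seriesFn {d k : ℕ}
    (p : EuclideanSpace ℝ (Fin d) → EuclideanSpace ℝ (Fin k)) (b : EuclideanSpace ℝ (Fin k)) :
    EuclideanSpace ℝ (Fin d) → ℝ :=
  fun x => inner ℝ (p x) b

/-- `ξ_k = sup_{x ∈ 𝒳} ‖p(x)‖` (meaningful when `p` is bounded on `𝒳`). -/
noncomputable def xiSup {d k : ℕ} (X : Set (EuclideanSpace ℝ (Fin d)))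
    (p : EuclideanSpace ℝ (Fin d) → EuclideanSpace ℝ (Fin k)) : ℝ :=
  sSup ((fun x => ‖p x‖) '' X)

/-- The regression error `ε_i = y_i - g(x_i)`. -/
def regErr {Ω : Type*} {d n : ℕ} (y : Fin n → Ω → ℝ)
    (x : Fin n → Ω → EuclideanSpace ℝ (Fin d)) (g : EuclideanSpace ℝ (Fin d) → ℝ)
    (i : Fin n) : Ω → ℝ :=
  fun ω => y i ω - g (x i ω)

/-- The σ-algebra generated by the covariate vector `x_i`. -/
abbrev sigmaOf {Ω : Type*} {d : ℕ} (x : Ω → EuclideanSpace ℝ (Fin d)) : MeasurableSpace Ω :=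
  MeasurableSpace.comap x inferInstance

/-- An i.i.d. sample `(y_i, x_i)`, `i = 1, …, n`, with `x_i ∈ 𝒳` of law `F`,
`y_i = g(x_i) + ε_i` and `E[ε_i | x_i] = 0`. -/
structure IsRegressionSample {Ω : Type*} [MeasurableSpace Ω] {d n : ℕ} (P : Measure Ω)
    (X : Set (EuclideanSpace ℝ (Fin d))) (F : Measure (EuclideanSpace ℝ (Fin d)))
    (g : EuclideanSpace ℝ (Fin d) → ℝ)
    (y : Fin n → Ω → ℝ) (x : Fin n → Ω → EuclideanSpace ℝ (Fin d)) : Prop where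
  measurable_y : ∀ i, Measurable (y i)
  measurable_x : ∀ i, Measurable (x i)
  indep : iIndepFun (fun i ω => (y i ω, x i ω)) P
  identDistrib : ∀ i j, IdentDistrib (fun ω => (y i ω, x i ω)) (fun ω => (y j ω, x j ω)) P P
  mem : ∀ i, ∀ᵐ ω ∂P, x i ω ∈ X
  law : ∀ i, P.map (x i) = F
  integrable_err : ∀ i, Integrable (regErr y x g i) P
  condExp_err : ∀ i, P[regErr y x g i | sigmaOf (x i)] =ᵐ[P] 0

/-- `E[ε_i² | x_i] ≤ C`, i.e. `σ̄² ≤ C`. -/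
def CondVarLE {Ω : Type*} [MeasurableSpace Ω] {d n : ℕ} (P : Measure Ω)
    (g : EuclideanSpace ℝ (Fin d) → ℝ)
    (y : Fin n → Ω → ℝ) (x : Fin n → Ω → EuclideanSpace ℝ (Fin d)) (C : ℝ) : Prop :=
  ∀ i, Integrable (fun ω => regErr y x g i ω ^ 2) P ∧
    ∀ᵐ ω ∂P, (P[fun ω => regErr y x g i ω ^ 2 | sigmaOf (x i)]) ω ≤ C

/-- The second moment matrix `Q = E[p(x_i) p(x_i)']`, where `x_i` has law `F`. -/
noncomputable def gramMatrix {d k : ℕ} (F : Measure (EuclideanSpace ℝ (Fin d)))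
    (p : EuclideanSpace ℝ (Fin d) → EuclideanSpace ℝ (Fin k)) : Matrix (Fin k) (Fin k) ℝ :=
  Matrix.of fun a b => ∫ x, p x a * p x b ∂F

/-- All eigenvalues of `Q` lie in `[lo, hi]`. -/
def EigenvaluesIn {d k : ℕ} (F : Measure (EuclideanSpace ℝ (Fin d)))
    (p : EuclideanSpace ℝ (Fin d) → EuclideanSpace ℝ (Fin k)) (lo hi : ℝ) : Prop :=
  ∀ t : ℝ, Module.End.HasEigenvalue (Matrix.toLin' (gramMatrix F p)) t → lo ≤ t ∧ t ≤ hi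

/-- `b = β_f`, a minimizer over `ℝᵏ` of `b ↦ E[(f(x_i) - p(x_i)'b)²]`, where `x_i` has law `F`. -/
def IsProjCoef {d k : ℕ} (F : Measure (EuclideanSpace ℝ (Fin d)))
    (p : EuclideanSpace ℝ (Fin d) → EuclideanSpace ℝ (Fin k))
    (f : EuclideanSpace ℝ (Fin d) → ℝ) (b : EuclideanSpace ℝ (Fin k)) : Prop :=
  IsMinOn (fun b' => ∫ x, (f x - seriesFn p b' x) ^ 2 ∂F) Set.univ b

/-- For every `f` in the class `G`, the error `r_f = f - p'β_f` satisfies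
`‖r_f‖_{F,2} ≤ c` and `‖r_f‖_{F,∞} = sup_{x ∈ 𝒳} |r_f(x)| ≤ ℓ c`. -/
def ApproxBound {d k : ℕ} (X : Set (EuclideanSpace ℝ (Fin d)))
    (F : Measure (EuclideanSpace ℝ (Fin d)))
    (p : EuclideanSpace ℝ (Fin d) → EuclideanSpace ℝ (Fin k))
    (G : Set (EuclideanSpace ℝ (Fin d) → ℝ)) (c l : ℝ) : Prop :=
  0 ≤ c ∧ ∀ f ∈ G, ∀ b, IsProjCoef F p f b →
    eLpNorm (f - seriesFn p b) 2 F ≤ ENNReal.ofReal c ∧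
    ∀ x ∈ X, |f x - seriesFn p b x| ≤ l * c

/-- `b` is the least squares parameter: a minimizer of `b ↦ E[(y_i - p(x_i)'b)²]`. -/
def IsLSParam {Ω : Type*} [MeasurableSpace Ω] {d k n : ℕ} (P : Measure Ω)
    (p : EuclideanSpace ℝ (Fin d) → EuclideanSpace ℝ (Fin k))
    (y : Fin n → Ω → ℝ) (x : Fin n → Ω → EuclideanSpace ℝ (Fin d))
    (b : EuclideanSpace ℝ (Fin k)) : Prop :=
  ∀ i, IsMinOn (fun b' => ∫ ω, (y i ω - seriesFn p b' (x i ω)) ^ 2 ∂P) Set.univ b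

/-- `b` is a least squares estimate for the data `(y_i, x_i)`, `i = 1, …, n`:
a minimizer of `b ↦ n⁻¹ ∑ᵢ (y_i - p(x_i)'b)²`. -/
def IsLSEstimate {d k n : ℕ}
    (p : EuclideanSpace ℝ (Fin d) → EuclideanSpace ℝ (Fin k))
    (y : Fin n → ℝ) (x : Fin n → EuclideanSpace ℝ (Fin d))
    (b : EuclideanSpace ℝ (Fin k)) : Prop :=
  IsMinOn (fun b' => (n : ℝ)⁻¹ * ∑ i, (y i - seriesFn p b' (x i)) ^ 2) Set.univ b

/-- `Z_n ≲_P a_n`, i.e. `Z_n = O_P(a_n)`, for nonnegative `Z_n` on probability spaces that may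
change with `n`. For sets that are not measurable `P n` is the outer probability. -/
def IsBigOP {Ω : ℕ → Type*} [∀ n, MeasurableSpace (Ω n)] (P : ∀ n, Measure (Ω n))
    (Z : ∀ n, Ω n → ℝ≥0∞) (a : ℕ → ℝ) : Prop :=
  ∀ δ : ℝ, 0 < δ → ∃ M : ℝ, 0 < M ∧
    ∀ᶠ n in atTop, P n {ω | ENNReal.ofReal (M * a n) < Z n ω} ≤ ENNReal.ofReal δ

/-! Everything is done for a fixed sample size `n > 0`; only the end lets `n` grow. The normal
equations give `∑ (p(xᵢ)'Δ)² = ∑ uᵢ p(xᵢ)'Δ` for `Δ = βhat - β` and `uᵢ = yᵢ - p(xᵢ)'β`. If the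
empirical Gram form is at least `n (lo/4) ‖·‖²`, then `‖Δ‖` is controlled by the score `∑ uᵢ p(xᵢ)`,
whose second moment is additive because its terms are independent and centred. Markov's inequality
and `‖p'Δ‖_{F,2} ≤ √hi ‖Δ‖` then give the rates.

The lower bound on the Gram form (`measure_exists_gram_lt_le`) is a one-sided matrix Chernoff bound
in the manner of Ahlswede and Winter. The Golden–Thompson inequality, obtained from trace
inequalities for powers `2^j` and the Lie product formula, peels off one rank-one term at a time,
and each term contracts `E tr exp(-K⁻¹ ∑ zᵢzᵢ')` by `1 - lo/(2K)`. With `K = ξ²` the failure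
probability is at most `k exp(-n lo/(4ξ²))`, which vanishes because `ξ² log n / n → 0` and `k lo ≤
tr Q ≤ ξ²`.

The two rates differ in how the approximation error `r = g - p'β` enters. For `g` as target, `r` is
taken out of the score and absorbed into the quadratic form, so `‖r‖_{F,2} ≤ c` suffices
(`IsLSEstimate.norm_sub_sq_le_add`). For `p'β` as target, `r` stays in the score, where it is
orthogonal to `p`, and it costs only `E ‖p‖² r²`; bounding either factor uniformly produces the
minimum (`integral_norm_sq_mul_sq_le`). -/

/-! ### Lie product formula -/

section LieProduct

/-- Telescoping. Having `r ^ N` in place of `r ^ (N - 1)` costs nothing later, where `r = exp (K /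
N)`. -/
theorem norm_pow_sub_pow_le {A : Type*} [NormedRing A] [NormOneClass A] {a b : A} {r : ℝ}
    (ha : ‖a‖ ≤ r) (hb : ‖b‖ ≤ r) (hr : 1 ≤ r) (N : ℕ) :
    ‖a ^ N - b ^ N‖ ≤ N * r ^ N * ‖a - b‖ := by
  have h0 : 0 ≤ r := by linarith
  induction N with
  | zero => simp
  | succ N ih =>
    have e : a ^ (N + 1) - b ^ (N + 1) = a ^ N * (a - b) + (a ^ N - b ^ N) * b := by
      rw [pow_succ, pow_succ]; noncomm_ring
    have h1 : ‖a ^ N * (a - b)‖ ≤ r ^ N * ‖a - b‖ :=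
      (norm_mul_le _ _).trans (by gcongr; exact (norm_pow_le a N).trans (by gcongr))
    have h2 : ‖(a ^ N - b ^ N) * b‖ ≤ (N * r ^ N * ‖a - b‖) * r :=
      (norm_mul_le _ _).trans (by gcongr)
    have h3 : r ^ N * ‖a - b‖ ≤ r ^ (N + 1) * ‖a - b‖ := by
      gcongr
      · omega
    calc ‖a ^ (N + 1) - b ^ (N + 1)‖ ≤ r ^ N * ‖a - b‖ + (N * r ^ N * ‖a - b‖) * r := by
          rw [e]; exact (norm_add_le _ _).trans (add_le_add h1 h2)
      _ ≤ r ^ (N + 1) * ‖a - b‖ + (N * r ^ N * ‖a - b‖) * r := by gcongr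
      _ = _ := by push_cast; ring

theorem norm_exp_le_exp_norm {A : Type*} [NormedRing A] [NormedAlgebra ℝ A] [NormOneClass A]
    [CompleteSpace A] (a : A) : ‖NormedSpace.exp a‖ ≤ Real.exp ‖a‖ := by
  have h := NormedSpace.exp_series_hasSum_exp' (𝕂 := ℝ) a
  have h' := NormedSpace.exp_series_hasSum_exp' (𝕂 := ℝ) ‖a‖
  rw [← Real.exp_eq_exp_ℝ] at h'
  refine tsum_of_norm_bounded h' (fun n => ?_) |> fun H => by rwa [h.tsum_eq] at H
  rw [norm_smul, Real.norm_of_nonneg (by positivity), smul_eq_mul]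
  gcongr
  exact norm_pow_le a n

/-- The two one-step factors agree to first order, so their difference at time `1/N` is `o(1/N)`;
telescoping over `N` steps multiplies it by at most `N exp K`. -/
theorem tendsto_lie_product {A : Type*} [NormedRing A] [NormedAlgebra ℝ A] [NormOneClass A]
    [CompleteSpace A] (a b : A) :
    Tendsto (fun N : ℕ => (NormedSpace.exp ((N : ℝ)⁻¹ • a) * NormedSpace.exp ((N : ℝ)⁻¹ • b)) ^ N)
      atTop (𝓝 (NormedSpace.exp (a + b))) := by
  set f : ℝ → A := fun t => NormedSpace.exp (t • (a + b)) -
    NormedSpace.exp (t • a) * NormedSpace.exp (t • b) with hf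
  have hd : HasDerivAt f 0 0 := by
    have h1 := hasDerivAt_exp_smul_const (𝕂 := ℝ) (a + b) (0 : ℝ)
    have h2 := hasDerivAt_exp_smul_const (𝕂 := ℝ) a (0 : ℝ)
    have h3 := hasDerivAt_exp_smul_const (𝕂 := ℝ) b (0 : ℝ)
    have : HasDerivAt f _ 0 := h1.sub (h2.mul h3)
    convert this using 1
    simp [NormedSpace.exp_zero]
  have h0 : f 0 = 0 := by simp [hf, NormedSpace.exp_zero]
  have hlim : Tendsto (fun N : ℕ => (N : ℝ) * ‖f ((N : ℝ)⁻¹)‖) atTop (𝓝 0) := by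
    have h := (hasDerivAt_iff_tendsto_slope_zero.1 hd)
    have hN : Tendsto (fun N : ℕ => ((N : ℝ)⁻¹)) atTop (𝓝[≠] 0) := by
      refine tendsto_nhdsWithin_iff.2 ⟨tendsto_inv_atTop_nhds_zero_nat, ?_⟩
      filter_upwards [eventually_gt_atTop 0] with N hN
      have : (N : ℝ) ≠ 0 := by positivity
      simpa using this
    have h' := (h.comp hN).norm
    rw [norm_zero] at h'
    refine h'.congr fun N => ?_
    simp [h0, norm_smul]
  set K := ‖a‖ + ‖b‖ with hK
  have hbound : ∀ N : ℕ, 0 < N →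
      ‖NormedSpace.exp (a + b) - (NormedSpace.exp ((N : ℝ)⁻¹ • a) *
        NormedSpace.exp ((N : ℝ)⁻¹ • b)) ^ N‖ ≤ Real.exp K * (N * ‖f ((N : ℝ)⁻¹)‖) := by
    intro N hN
    have hN0 : (N : ℝ) ≠ 0 := by positivity
    have e1 : NormedSpace.exp (a + b) = NormedSpace.exp ((N : ℝ)⁻¹ • (a + b)) ^ N := by
      let : NormedAlgebra ℚ A := NormedAlgebra.restrictScalars ℚ ℝ A
      rw [← NormedSpace.exp_nsmul, ← Nat.cast_smul_eq_nsmul ℝ, smul_smul, mul_inv_cancel₀ hN0,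
        one_smul]
    have n1 : ‖NormedSpace.exp ((N : ℝ)⁻¹ • (a + b))‖ ≤ Real.exp (K / N) := by
      refine (norm_exp_le_exp_norm _).trans (Real.exp_le_exp.2 ?_)
      rw [norm_smul, norm_inv, Real.norm_natCast, div_eq_inv_mul]
      gcongr
      exact norm_add_le _ _
    have n2 : ‖NormedSpace.exp ((N : ℝ)⁻¹ • a) * NormedSpace.exp ((N : ℝ)⁻¹ • b)‖
        ≤ Real.exp (K / N) := by
      refine (norm_mul_le _ _).trans ((mul_le_mul (norm_exp_le_exp_norm _)
        (norm_exp_le_exp_norm _) (norm_nonneg _) (Real.exp_pos _).le).trans ?_)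
      rw [← Real.exp_add, norm_smul, norm_smul, norm_inv, Real.norm_natCast, hK]
      apply le_of_eq; congr 1; ring
    have := norm_pow_sub_pow_le n1 n2 (Real.one_le_exp (by positivity)) N
    rw [← e1, ← Real.exp_nat_mul, mul_div_cancel₀ _ hN0] at this
    refine this.trans (le_of_eq ?_)
    simp only [hf]; ring
  rw [tendsto_iff_norm_sub_tendsto_zero]
  refine squeeze_zero' (Eventually.of_forall fun _ => norm_nonneg _) ?_
    (by simpa using hlim.const_mul (Real.exp K))
  filter_upwards [eventually_gt_atTop 0] with N hN
  rw [norm_sub_rev]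
  exact hbound N hN

end LieProduct

/-! ### Golden–Thompson inequality -/

namespace Matrix

variable {m : Type*} [Fintype m] [DecidableEq m]

omit [DecidableEq m] in
theorem trace_mul_self_le (M : Matrix m m ℝ) : (M * M).trace ≤ (M * Mᵀ).trace := by
  have h : 0 ≤ ∑ i, ∑ j, (M i j - M j i) ^ 2 := by positivity
  have e : ∑ i, ∑ j, (M i j - M j i) ^ 2 = 2 * (M * Mᵀ).trace - 2 * (M * M).trace := by
    simp only [trace, diag, mul_apply, transpose_apply, sub_sq, Finset.sum_add_distrib,
      Finset.sum_sub_distrib]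
    rw [Finset.sum_comm (f := fun i j => M j i ^ 2)]
    simp only [mul_assoc, ← Finset.mul_sum, pow_two]
    ring
  linarith

theorem two_mul_trace_mul_le {X Y : Matrix m m ℝ} (hX : Xᵀ = X) (hY : Yᵀ = Y) :
    2 * (X * Y).trace ≤ (X * X).trace + (Y * Y).trace := by
  have h : 0 ≤ ((X - Y) * (X - Y)ᵀ).trace := by
    simp only [trace, diag, mul_apply, transpose_apply]
    exact Finset.sum_nonneg fun i _ => Finset.sum_nonneg fun j _ => mul_self_nonneg _
  rw [transpose_sub, hX, hY] at h
  have e : (X - Y) * (X - Y) = X * X - X * Y - Y * X + Y * Y := by noncomm_ring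
  rw [e, trace_add, trace_sub, trace_sub, trace_mul_comm Y X] at h
  linarith

theorem trace_mul_pow_comm (X Y : Matrix m m ℝ) (n : ℕ) :
    ((X * Y) ^ n).trace = ((Y * X) ^ n).trace := by
  cases n with
  | zero => simp
  | succ n =>
    have : (X * Y) ^ (n + 1) = X * ((Y * X) ^ n * Y) := by
      have h : SemiconjBy X (Y * X) (X * Y) := by simp [SemiconjBy, mul_assoc]
      rw [← mul_assoc, (h.pow_right n).eq, pow_succ, mul_assoc]
    rw [this, trace_mul_comm, pow_succ, mul_assoc]

/-- The two claims feed each other. The first at `M = X * Y`, with cyclicity, reduces the second to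
`X ^ 2`, `Y ^ 2` at level `j`. The first at `M ^ 2` leads to the product of `Mᵀ * M` and `M * Mᵀ`;
the second claim separates these factors, and AM–GM applies because their powers have equal traces.
-/
theorem trace_pow_two_pow_aux (j : ℕ) :
    (∀ M : Matrix m m ℝ, (M ^ 2 ^ (j + 1)).trace ≤ ((M * Mᵀ) ^ 2 ^ j).trace) ∧
    (∀ X Y : Matrix m m ℝ, Xᵀ = X → Yᵀ = Y →
      ((X * Y) ^ 2 ^ j).trace ≤ (X ^ 2 ^ j * Y ^ 2 ^ j).trace) := by
  induction j with
  | zero => exact ⟨fun M => by simpa [pow_two] using trace_mul_self_le M, fun X Y _ _ => by simp⟩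
  | succ j ih =>
    obtain ⟨ihL, ihT⟩ := ih
    have hT : ∀ X Y : Matrix m m ℝ, Xᵀ = X → Yᵀ = Y →
        ((X * Y) ^ 2 ^ (j + 1)).trace ≤ (X ^ 2 ^ (j + 1) * Y ^ 2 ^ (j + 1)).trace := by
      intro X Y hX hY
      have h1 := ihL (X * Y)
      have h2 : ((X * Y * (X * Y)ᵀ) ^ 2 ^ j).trace = ((X ^ 2 * Y ^ 2) ^ 2 ^ j).trace := by
        rw [transpose_mul, hX, hY, trace_mul_pow_comm (X ^ 2),
          show X * Y * (Y * X) = X * (Y ^ 2 * X) by noncomm_ring, trace_mul_pow_comm X,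
          show Y ^ 2 * X * X = Y ^ 2 * X ^ 2 by noncomm_ring]
      have h3 := ihT (X ^ 2) (Y ^ 2) (by rw [transpose_pow, hX]) (by rw [transpose_pow, hY])
      rw [← pow_mul, ← pow_mul, ← pow_succ'] at h3
      exact h1.trans (h2.le.trans h3)
    refine ⟨fun M => ?_, hT⟩
    have h1 := ihL (M ^ 2)
    have h2 : ((M ^ 2 * (M ^ 2)ᵀ) ^ 2 ^ j).trace = ((Mᵀ * M * (M * Mᵀ)) ^ 2 ^ j).trace := by
      rw [transpose_pow, show M ^ 2 * Mᵀ ^ 2 = M * M * Mᵀ * Mᵀ by noncomm_ring,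
        trace_mul_pow_comm (M * M * Mᵀ)]
      congr 2
      noncomm_ring
    have h3 := ihT (Mᵀ * M) (M * Mᵀ) (by simp) (by simp)
    have h4 := two_mul_trace_mul_le (X := (Mᵀ * M) ^ 2 ^ j) (Y := (M * Mᵀ) ^ 2 ^ j)
      (by rw [transpose_pow]; simp) (by rw [transpose_pow]; simp)
    rw [← pow_add, ← pow_add, ← two_mul, ← pow_succ', trace_mul_pow_comm Mᵀ M] at h4
    rw [← pow_mul, ← pow_succ'] at h1
    linarith

theorem trace_mul_pow_two_pow_le {X Y : Matrix m m ℝ} (hX : Xᵀ = X) (hY : Yᵀ = Y) (j : ℕ) :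
    ((X * Y) ^ 2 ^ j).trace ≤ (X ^ 2 ^ j * Y ^ 2 ^ j).trace :=
  (trace_pow_two_pow_aux j).2 X Y hX hY

theorem exp_inv_smul_pow (X : Matrix m m ℝ) {N : ℕ} (hN : 0 < N) :
    NormedSpace.exp ((N : ℝ)⁻¹ • X) ^ N = NormedSpace.exp X := by
  have hN0 : (N : ℝ) ≠ 0 := by positivity
  rw [← Matrix.exp_nsmul, ← Nat.cast_smul_eq_nsmul ℝ, smul_smul, mul_inv_cancel₀ hN0, one_smul]

theorem trace_exp_add_le {X Y : Matrix m m ℝ} (hX : Xᵀ = X) (hY : Yᵀ = Y) :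
    (NormedSpace.exp (X + Y)).trace ≤ (NormedSpace.exp X * NormedSpace.exp Y).trace := by
  rcases isEmpty_or_nonempty m with hm | hm
  -- The norm of the identity is `1` only when `m` is nonempty, so the empty case is separate.
  · simp [trace]
  let : NormedRing (Matrix m m ℝ) := Matrix.linftyOpNormedRing
  let : NormedAlgebra ℝ (Matrix m m ℝ) := Matrix.linftyOpNormedAlgebra
  have : NormOneClass (Matrix m m ℝ) := Matrix.linfty_opNormOneClass
  -- The power inequality is available only for dyadic exponents, so the limit is taken along `N = 2
  -- ^ j`.
  have h := (tendsto_lie_product X Y).comp (tendsto_pow_atTop_atTop_of_one_lt one_lt_two)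
  have hc : Continuous (trace : Matrix m m ℝ → ℝ) := continuous_id.matrix_trace
  refine le_of_tendsto ((hc.tendsto _).comp h) (Eventually.of_forall fun j => ?_)
  have hs : ∀ Z : Matrix m m ℝ, Zᵀ = Z → ∀ N : ℕ, (NormedSpace.exp ((N : ℝ)⁻¹ • Z))ᵀ =
      NormedSpace.exp ((N : ℝ)⁻¹ • Z) := by
    intro Z hZ N
    rw [← Matrix.exp_transpose, transpose_smul, hZ]
  have := trace_mul_pow_two_pow_le (hs X hX (2 ^ j)) (hs Y hY (2 ^ j)) j
  rw [exp_inv_smul_pow X (by positivity), exp_inv_smul_pow Y (by positivity)] at this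
  exact this

end Matrix

/-! ### Rank-one exponentials and spectral bounds for quadratic forms. -/

theorem exp_smul_of_mul_self_eq {A : Type*} [NormedRing A] [NormedAlgebra ℝ A] [CompleteSpace A]
    {b : A} {s : ℝ} (hs : s ≠ 0) (hb : b * b = s • b) (c : ℝ) :
    NormedSpace.exp (c • b) = 1 + ((Real.exp (c * s) - 1) / s) • b := by
  have hpow : ∀ n : ℕ, b ^ (n + 1) = s ^ n • b := by
    intro n
    induction n with
    | zero => simp
    | succ n ih => rw [pow_succ, ih, smul_mul_assoc, hb, smul_smul, ← pow_succ]
  have h1 := NormedSpace.exp_series_hasSum_exp' (𝕂 := ℝ) (c • b)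
  have h2 := NormedSpace.exp_series_hasSum_exp' (𝕂 := ℝ) (c * s)
  rw [← Real.exp_eq_exp_ℝ] at h2
  -- The series is the scalar one times `s⁻¹ • b`, except that its zeroth term is `1`; the second
  -- summand corrects this.
  have h3 := (h2.smul_const (s⁻¹ • b)).add (hasSum_ite_eq (0 : ℕ) (1 - s⁻¹ • b))
  refine h1.unique (?_ : HasSum _ _) 
  convert! h3 using 1
  · funext n
    cases n with
    | zero => simp
    | succ n =>
      simp only [smul_pow, hpow, smul_smul, smul_eq_mul, Nat.add_eq_zero_iff, one_ne_zero, and_false, if_false, add_zero]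
      congr 1
      field_simp
      try ring
  · rw [smul_smul, sub_div, sub_smul, div_eq_mul_inv, div_eq_mul_inv, one_mul]
    abel

namespace Matrix
variable {m : Type*} [Fintype m] [DecidableEq m]

theorem dotProduct_exp_mulVec_nonneg {X : Matrix m m ℝ} (hX : Xᵀ = X) (v : m → ℝ) :
    0 ≤ v ⬝ᵥ NormedSpace.exp X *ᵥ v := by
  have e := exp_inv_smul_pow X (N := 2) two_pos
  set H := NormedSpace.exp (((2 : ℕ) : ℝ)⁻¹ • X)
  have hH : Hᵀ = H := by rw [← Matrix.exp_transpose, transpose_smul, hX]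
  rw [← e, pow_two, ← mulVec_mulVec, dotProduct_mulVec, ← mulVec_transpose, hH]
  exact Finset.sum_nonneg fun i _ => mul_self_nonneg _

omit [DecidableEq m] in
theorem trace_mul_vecMulVec_self (X : Matrix m m ℝ) (v : m → ℝ) :
    (X * vecMulVec v v).trace = v ⬝ᵥ X *ᵥ v := by
  rw [mul_vecMulVec, trace_vecMulVec, dotProduct_comm]

/-- Golden–Thompson splits off the rank-one term, whose exponential is explicit. The one-step
decrease drives the Chernoff bound. -/
theorem trace_exp_sub_vecMulVec_le {X : Matrix m m ℝ} (hX : Xᵀ = X) {v : m → ℝ} {K : ℝ}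
    (hK : 0 < K) (hv : v ⬝ᵥ v ≤ K) :
    (NormedSpace.exp (X - K⁻¹ • vecMulVec v v)).trace ≤
      (NormedSpace.exp X).trace - (2 * K)⁻¹ * (v ⬝ᵥ NormedSpace.exp X *ᵥ v) := by
  rcases eq_or_ne (v ⬝ᵥ v) 0 with h0 | h0
  · have : v = 0 := dotProduct_self_eq_zero.1 h0
    subst this; simp
  have hs : 0 < v ⬝ᵥ v :=
    lt_of_le_of_ne (Finset.sum_nonneg fun i _ => mul_self_nonneg _) (Ne.symm h0)
  set s := v ⬝ᵥ v with hsdef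
  have hGT := trace_exp_add_le (Y := (-K⁻¹) • vecMulVec v v) hX
    (by rw [transpose_smul, transpose_vecMulVec])
  have hexp : NormedSpace.exp ((-K⁻¹) • vecMulVec v v) =
      1 + ((Real.exp (-K⁻¹ * s) - 1) / s) • vecMulVec v v := by
    let : NormedRing (Matrix m m ℝ) := Matrix.linftyOpNormedRing
    let : NormedAlgebra ℝ (Matrix m m ℝ) := Matrix.linftyOpNormedAlgebra
    refine exp_smul_of_mul_self_eq h0 ?_ _
    rw [vecMulVec_mul_vecMulVec, vecMulVec_smul]
  rw [hexp, mul_add, mul_one, mul_smul_comm, trace_add, trace_smul,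
    trace_mul_vecMulVec_self, neg_smul, ← sub_eq_add_neg, smul_eq_mul] at hGT
  have hcoef : (Real.exp (-K⁻¹ * s) - 1) / s ≤ -(2 * K)⁻¹ := by
    rw [div_le_iff₀ hs]
    set t := K⁻¹ * s with ht
    have ht0 : 0 < t := by positivity
    have ht1 : t ≤ 1 := by rw [ht, inv_mul_le_iff₀ hK]; linarith
    -- Valid on `[0, 1]`: there `exp (-t) ≤ 1 / (1 + t)` and `(1 - t/2)(1 + t) ≥ 1`. This is where
    -- `v ⬝ᵥ v ≤ K` is needed.
    have h1 : Real.exp (-t) ≤ 1 - t / 2 := by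
      rw [Real.exp_neg, inv_le_comm₀ (Real.exp_pos _) (by linarith)]
      refine le_trans ?_ (Real.add_one_le_exp t)
      rw [inv_le_iff_one_le_mul₀ (by linarith)]
      nlinarith
    have h2 : -(2 * K)⁻¹ * s = -(t / 2) := by rw [ht]; field_simp
    rw [neg_mul, h2]
    linarith
  have hq := dotProduct_exp_mulVec_nonneg hX v
  nlinarith

theorem IsHermitian.exists_eq_conj_diagonal {X : Matrix m m ℝ} (hX : X.IsHermitian) :
    ∃ U : Matrix m m ℝ, Uᵀ * U = 1 ∧ U * Uᵀ = 1 ∧ X = U * diagonal hX.eigenvalues * Uᵀ := by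
  refine ⟨hX.eigenvectorUnitary, ?_, ?_, ?_⟩
  · simpa [star_eq_conjTranspose] using Unitary.coe_star_mul_self hX.eigenvectorUnitary
  · simpa [star_eq_conjTranspose] using Unitary.coe_mul_star_self hX.eigenvectorUnitary
  · have h := hX.spectral_theorem
    rw [Unitary.conjStarAlgAut_apply] at h
    exact h

theorem IsHermitian.trace_exp_smul {X : Matrix m m ℝ} (hX : X.IsHermitian) (t : ℝ) :
    (NormedSpace.exp (t • X)).trace = ∑ i, Real.exp (t * hX.eigenvalues i) := by
  obtain ⟨U, hU1, hU2, h⟩ := hX.exists_eq_conj_diagonal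
  have hinv : U⁻¹ = Uᵀ := inv_eq_right_inv hU2
  have h' : t • X = U * diagonal (t • hX.eigenvalues) * U⁻¹ := by
    rw [diagonal_smul, hinv, mul_smul_comm, smul_mul_assoc, ← h]
  rw [h', Matrix.exp_conj _ _ (IsUnit.of_mul_eq_one _ hU2), trace_mul_comm, ← mul_assoc, hinv,
    hU1, one_mul, exp_diagonal, trace_diagonal]
  refine Finset.sum_congr rfl fun i _ => ?_
  rw [Pi.coe_exp, ← Real.exp_eq_exp_ℝ]
  simp

theorem IsHermitian.exists_quadForm_eq_sum {X : Matrix m m ℝ} (hX : X.IsHermitian) (v : m → ℝ) :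
    ∃ w : m → ℝ, v ⬝ᵥ v = ∑ i, w i * w i ∧
      v ⬝ᵥ X *ᵥ v = ∑ i, hX.eigenvalues i * (w i * w i) := by
  obtain ⟨U, hU1, hU2, h⟩ := hX.exists_eq_conj_diagonal
  refine ⟨Uᵀ *ᵥ v, ?_, ?_⟩
  · rw [← dotProduct, dotProduct_mulVec, vecMul_mulVec, transpose_transpose, hU2, vecMul_one]
  · conv_lhs => rw [h]
    rw [← mulVec_mulVec, ← mulVec_mulVec, dotProduct_mulVec, ← mulVec_transpose]
    simp only [dotProduct, mulVec_diagonal]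
    exact Finset.sum_congr rfl fun i _ => by ring

theorem IsHermitian.le_dotProduct_mulVec {X : Matrix m m ℝ} (hX : X.IsHermitian) {a : ℝ}
    (ha : ∀ i, a ≤ hX.eigenvalues i) (v : m → ℝ) : a * (v ⬝ᵥ v) ≤ v ⬝ᵥ X *ᵥ v := by
  obtain ⟨w, h1, h2⟩ := hX.exists_quadForm_eq_sum v
  rw [h1, h2, Finset.mul_sum]
  exact Finset.sum_le_sum fun i _ => mul_le_mul_of_nonneg_right (ha i) (mul_self_nonneg _)

theorem IsHermitian.dotProduct_mulVec_le {X : Matrix m m ℝ} (hX : X.IsHermitian) {a : ℝ}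
    (ha : ∀ i, hX.eigenvalues i ≤ a) (v : m → ℝ) : v ⬝ᵥ X *ᵥ v ≤ a * (v ⬝ᵥ v) := by
  obtain ⟨w, h1, h2⟩ := hX.exists_quadForm_eq_sum v
  rw [h1, h2, Finset.mul_sum]
  exact Finset.sum_le_sum fun i _ => mul_le_mul_of_nonneg_right (ha i) (mul_self_nonneg _)

/-- A direction with small Rayleigh quotient forces an eigenvalue below `a`, and that eigenvalue
alone contributes enough to the trace. The event "some direction is bad" thus becomes an event about
one scalar. -/
theorem exp_le_trace_exp_of_lt {X : Matrix m m ℝ} (hX : X.IsHermitian) {a t : ℝ} (ht : 0 ≤ t)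
    {v : m → ℝ} (hv : v ⬝ᵥ X *ᵥ v < a * (v ⬝ᵥ v)) :
    Real.exp (-(t * a)) ≤ (NormedSpace.exp (-t • X)).trace := by
  by_contra! hcon
  refine hv.not_ge (hX.le_dotProduct_mulVec (fun i => ?_) v)
  by_contra! hi
  rw [hX.trace_exp_smul] at hcon
  have h1 := Finset.single_le_sum (f := fun j => Real.exp (-t * hX.eigenvalues j))
    (fun j _ => (Real.exp_pos _).le) (Finset.mem_univ i)
  have h2 : Real.exp (-(t * a)) ≤ Real.exp (-t * hX.eigenvalues i) :=
    Real.exp_le_exp.2 (by nlinarith)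
  exact absurd (h2.trans h1) hcon.not_ge

end Matrix

/-! ### Lower tail of the smallest eigenvalue of a random Gram matrix -/

section GramTail

open Matrix

variable {m : Type*} [Fintype m] [DecidableEq m]

/-- `exp(-t ∑ w_i w_i')`. -/
noncomputable def expGram {ι : Type*} (t : ℝ) (s : Finset ι) (w : ι → m → ℝ) : Matrix m m ℝ :=
  NormedSpace.exp (-t • ∑ i ∈ s, vecMulVec (w i) (w i))

omit [Fintype m] [DecidableEq m] in
theorem transpose_smul_sum_vecMulVec {ι : Type*} (t : ℝ) (s : Finset ι) (w : ι → m → ℝ) :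
    (t • ∑ i ∈ s, vecMulVec (w i) (w i))ᵀ = t • ∑ i ∈ s, vecMulVec (w i) (w i) := by
  simp [transpose_sum, transpose_vecMulVec]

theorem continuous_expGram {ι : Type*} (t : ℝ) (s : Finset ι) :
    Continuous (expGram (m := m) t s) := by
  have h : Continuous fun w : ι → m → ℝ => -t • ∑ i ∈ s, vecMulVec (w i) (w i) :=
    Continuous.const_smul (continuous_finsetSum s fun i _ =>
      (continuous_apply i).matrix_vecMulVec (continuous_apply i)) (-t)
  let : NormedRing (Matrix m m ℝ) := Matrix.linftyOpNormedRing
  let : NormedAlgebra ℝ (Matrix m m ℝ) := Matrix.linftyOpNormedAlgebra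
  let : NormedAlgebra ℚ (Matrix m m ℝ) := NormedAlgebra.restrictScalars ℚ ℝ _
  exact NormedSpace.exp_continuous.comp h

/-- With `H = exp (X / 2)` symmetric, the right side is `tr (H Q H)`, a sum of the quadratic form of
`Q` over the rows of `H`, while `tr (H H)` is the sum of their squared lengths. -/
theorem Matrix.mul_trace_exp_le_trace_exp_mul {X Q : Matrix m m ℝ} (hX : Xᵀ = X) {lo : ℝ}
    (hQ : ∀ v : m → ℝ, lo * (v ⬝ᵥ v) ≤ v ⬝ᵥ Q *ᵥ v) :
    lo * (NormedSpace.exp X).trace ≤ (NormedSpace.exp X * Q).trace := by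
  have e := exp_inv_smul_pow X (N := 2) two_pos
  set H := NormedSpace.exp (((2 : ℕ) : ℝ)⁻¹ • X)
  have hH : Hᵀ = H := by rw [← Matrix.exp_transpose, transpose_smul, hX]
  rw [← e, pow_two, mul_assoc, trace_mul_comm H (H * Q), trace, trace, Finset.mul_sum]
  refine Finset.sum_le_sum fun i _ => ?_
  have h := hQ (H i)
  have hrow : (fun j => H j i) = H i := funext fun j => congrFun (congrFun hH i) j
  have e1 : (H * H) i i = H i ⬝ᵥ H i := by rw [mul_apply', hrow]
  have e2 : (H * Q * H) i i = H i ⬝ᵥ Q *ᵥ H i := by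
    rw [dotProduct_mulVec, mul_apply', hrow]
    rfl
  rw [diag_apply, diag_apply, e1, e2]
  exact h

variable {Ω ι : Type*} [MeasurableSpace Ω] [Fintype ι] [DecidableEq ι] {P : Measure Ω}
  [IsProbabilityMeasure P]

omit [DecidableEq m] [DecidableEq ι] in
theorem integrable_comp_of_ae_bounded {z : ι → Ω → m → ℝ}
    (hz : ∀ i, Measurable (z i)) {K : ℝ} (hzK : ∀ i, ∀ᵐ ω ∂P, z i ω ⬝ᵥ z i ω ≤ K)
    {f : (ι → m → ℝ) → ℝ} (hf : Continuous f) :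
    Integrable (fun ω => f fun i => z i ω) P := by
  have hzm : Measurable fun ω i => z i ω := measurable_pi_lambda _ hz
  obtain ⟨C, hC⟩ := (isCompact_closedBall (0 : ι → m → ℝ) (√K)).exists_bound_of_continuousOn
    hf.continuousOn
  refine Integrable.of_bound (hf.measurable.comp hzm).aestronglyMeasurable C ?_
  filter_upwards [ae_all_iff.2 hzK] with ω hω
  refine hC _ ?_
  rw [mem_closedBall_zero_iff, pi_norm_le_iff_of_nonneg (Real.sqrt_nonneg _)]
  refine fun i => (pi_norm_le_iff_of_nonneg (Real.sqrt_nonneg _)).2 fun a => ?_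
  rw [Real.norm_eq_abs]
  refine Real.abs_le_sqrt ((le_trans ?_ (hω i)))
  rw [pow_two]
  exact Finset.single_le_sum (f := fun a => z i ω a * z i ω a) (fun _ _ => mul_self_nonneg _)
    (Finset.mem_univ a)

/-- Induction on `s`: the new vector is independent of the earlier exponential, so its outer product
averages to `Q`, and `Q ≥ lo` turns the one-step decrease into a factor. -/
theorem integral_trace_expGram_le {z : ι → Ω → m → ℝ} (hz : ∀ i, Measurable (z i))
    (hind : iIndepFun z P) {K lo : ℝ} (hK : 0 < K) (hloK : lo ≤ 2 * K)
    (hzK : ∀ i, ∀ᵐ ω ∂P, z i ω ⬝ᵥ z i ω ≤ K) {Q : Matrix m m ℝ}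
    (hQz : ∀ i a b, ∫ ω, z i ω a * z i ω b ∂P = Q a b)
    (hQ : ∀ v : m → ℝ, lo * (v ⬝ᵥ v) ≤ v ⬝ᵥ Q *ᵥ v) (s : Finset ι) :
    ∫ ω, (expGram K⁻¹ s fun i => z i ω).trace ∂P ≤
      Fintype.card m * (1 - (2 * K)⁻¹ * lo) ^ s.card := by
  induction s using Finset.induction_on with
  | empty => simp [expGram, NormedSpace.exp_zero]
  | insert i s hi ih =>
    set A : Ω → Matrix m m ℝ := fun ω => expGram K⁻¹ s fun i => z i ω with hA
    have hc := continuous_expGram (m := m) K⁻¹ s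
    have hAint : ∀ a b, Integrable (fun ω => A ω a b) P := fun a b =>
      integrable_comp_of_ae_bounded hz hzK (hc.matrix_elem a b)
    have hAz : ∀ a b, Integrable (fun ω => A ω a b * (z i ω b * z i ω a)) P := fun a b =>
      integrable_comp_of_ae_bounded hz hzK
        (f := fun w => expGram K⁻¹ s w a b * (w i b * w i a))
        ((hc.matrix_elem a b).mul (by fun_prop))
    have htr : Integrable (fun ω => (A ω).trace) P :=
      integrable_comp_of_ae_bounded hz hzK hc.matrix_trace
    have hind' : ∀ a b, ∫ ω, A ω a b * (z i ω b * z i ω a) ∂P = (∫ ω, A ω a b ∂P) * Q b a := by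
      intro a b
      have h := hind.indepFun_finset s {i} (by simpa using hi) hz
      have h' := h.comp (φ := fun w : s → m → ℝ => expGram K⁻¹ Finset.univ w a b)
        (ψ := fun w : ({i} : Finset ι) → m → ℝ =>
          w ⟨i, by simp⟩ b * w ⟨i, by simp⟩ a)
        ((continuous_expGram _ _).matrix_elem a b).measurable (by fun_prop)
      have e : (fun w : s → m → ℝ => expGram K⁻¹ Finset.univ w a b) ∘
          (fun ω (j : s) => z j ω) = fun ω => A ω a b := by
        funext ω
        simp only [hA, expGram, Function.comp]
        rw [Finset.sum_coe_sort s fun j => vecMulVec (z j ω) (z j ω)]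
      rw [e] at h'
      have := h'.integral_fun_mul_eq_mul_integral (hAint a b).aestronglyMeasurable
        (Measurable.aestronglyMeasurable (by fun_prop))
      simp only [Function.comp] at this
      rw [this, hQz]
    have hsplit : ∀ ω, z i ω ⬝ᵥ A ω *ᵥ z i ω = ∑ a, ∑ b, A ω a b * (z i ω b * z i ω a) := by
      intro ω
      simp only [dotProduct, mulVec, Finset.mul_sum]
      exact Finset.sum_congr rfl fun a _ => Finset.sum_congr rfl fun b _ => by ring
    have hquad : Integrable (fun ω => z i ω ⬝ᵥ A ω *ᵥ z i ω) P := by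
      simp only [hsplit]
      exact integrable_finsetSum _ fun a _ => integrable_finsetSum _ fun b _ => hAz a b
    have hlow : lo * ∫ ω, (A ω).trace ∂P ≤ ∫ ω, z i ω ⬝ᵥ A ω *ᵥ z i ω ∂P := by
      have e : ∫ ω, z i ω ⬝ᵥ A ω *ᵥ z i ω ∂P = ∫ ω, (A ω * Q).trace ∂P := by
        simp only [hsplit, trace, diag_apply, mul_apply]
        rw [integral_finsetSum _ fun a _ => integrable_finsetSum _ fun b _ => hAz a b,
          integral_finsetSum _ fun a _ => integrable_finsetSum _ fun b _ =>
            (hAint a b).mul_const _]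
        refine Finset.sum_congr rfl fun a _ => ?_
        rw [integral_finsetSum _ fun b _ => hAz a b,
          integral_finsetSum _ fun b _ => (hAint a b).mul_const _]
        exact Finset.sum_congr rfl fun b _ => by rw [hind', integral_mul_const]
      rw [e, ← integral_const_mul]
      refine integral_mono (htr.const_mul _) ?_ fun ω =>
        mul_trace_exp_le_trace_exp_mul (transpose_smul_sum_vecMulVec _ _ _) hQ
      simp only [trace, diag_apply, mul_apply]
      exact integrable_finsetSum _ fun a _ => integrable_finsetSum _ fun b _ =>
        (hAint a b).mul_const _
    have hstep : ∫ ω, (expGram K⁻¹ (insert i s) fun i => z i ω).trace ∂P ≤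
        ∫ ω, ((A ω).trace - (2 * K)⁻¹ * (z i ω ⬝ᵥ A ω *ᵥ z i ω)) ∂P := by
      refine integral_mono_ae (integrable_comp_of_ae_bounded hz hzK
        (continuous_expGram _ _).matrix_trace) (htr.sub (hquad.const_mul _)) ?_
      filter_upwards [hzK i] with ω hω
      have := trace_exp_sub_vecMulVec_le
        (transpose_smul_sum_vecMulVec (-K⁻¹) s fun i => z i ω) hK hω
      refine le_trans (le_of_eq ?_) this
      rw [expGram, Finset.sum_insert hi, smul_add, neg_smul, neg_smul, sub_eq_add_neg, add_comm]
    rw [integral_sub htr (hquad.const_mul _), integral_const_mul] at hstep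
    have hfac : 0 ≤ 1 - (2 * K)⁻¹ * lo := by
      rw [sub_nonneg, inv_mul_le_iff₀ (by positivity)]; linarith
    rw [Finset.card_insert_of_notMem hi, pow_succ]
    have hK' : 0 < (2 * K)⁻¹ := by positivity
    calc _ ≤ _ := hstep
      _ ≤ (∫ ω, (A ω).trace ∂P) * (1 - (2 * K)⁻¹ * lo) := by nlinarith
      _ ≤ _ := by rw [← mul_assoc]; exact mul_le_mul_of_nonneg_right ih hfac

theorem measure_exists_gram_lt_le {z : ι → Ω → m → ℝ} (hz : ∀ i, Measurable (z i))
    (hind : iIndepFun z P) {K lo : ℝ} (hK : 0 < K) (hloK : lo ≤ 2 * K)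
    (hzK : ∀ i, ∀ᵐ ω ∂P, z i ω ⬝ᵥ z i ω ≤ K) {Q : Matrix m m ℝ}
    (hQz : ∀ i a b, ∫ ω, z i ω a * z i ω b ∂P = Q a b)
    (hQ : ∀ v : m → ℝ, lo * (v ⬝ᵥ v) ≤ v ⬝ᵥ Q *ᵥ v) :
    P {ω | ∃ v : m → ℝ, ∑ i, (z i ω ⬝ᵥ v) ^ 2 < Fintype.card ι * (lo / 4) * (v ⬝ᵥ v)} ≤
      ENNReal.ofReal (Fintype.card m * Real.exp (-(Fintype.card ι * lo / (4 * K)))) := by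
  set a : ℝ := Fintype.card ι * (lo / 4) with ha
  set E : Ω → ℝ := fun ω => (expGram K⁻¹ Finset.univ fun i => z i ω).trace with hE
  have hEint : Integrable E P :=
    integrable_comp_of_ae_bounded hz hzK (continuous_expGram _ _).matrix_trace
  have hE0 : ∀ ω, 0 ≤ E ω := fun ω => by
    -- With `lo = 0` and `Q = 1` the lemma says that the trace is nonnegative.
    have h := mul_trace_exp_le_trace_exp_mul (Q := 1) (lo := 0)
      (transpose_smul_sum_vecMulVec (-K⁻¹) Finset.univ fun i => z i ω)
      (fun v => by rw [zero_mul, one_mulVec]; exact Finset.sum_nonneg fun i _ => mul_self_nonneg _)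
    rwa [zero_mul, mul_one] at h
  have hsub : {ω | ∃ v : m → ℝ, ∑ i, (z i ω ⬝ᵥ v) ^ 2 < a * (v ⬝ᵥ v)} ⊆
      {ω | Real.exp (-(K⁻¹ * a)) ≤ E ω} := by
    rintro ω ⟨v, hv⟩
    refine exp_le_trace_exp_of_lt (X := ∑ i, vecMulVec (z i ω) (z i ω)) (v := v) ?_
      (by positivity) ?_
    · simpa [IsHermitian, conjTranspose_eq_transpose_of_trivial] using
        transpose_smul_sum_vecMulVec 1 Finset.univ fun i => z i ω
    · refine lt_of_eq_of_lt ?_ hv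
      rw [sum_mulVec, dotProduct_sum]
      refine Finset.sum_congr rfl fun i _ => ?_
      rw [vecMulVec_mulVec, dotProduct_smul, dotProduct_comm v]
      simp [pow_two]
  have hmk := mul_meas_ge_le_integral_of_nonneg (ae_of_all _ hE0) hEint (Real.exp (-(K⁻¹ * a)))
  have hint := integral_trace_expGram_le hz hind hK hloK hzK hQz hQ Finset.univ
  rw [Finset.card_univ] at hint
  have hfac : 0 ≤ 1 - (2 * K)⁻¹ * lo := by
    rw [sub_nonneg, inv_mul_le_iff₀ (by positivity)]; linarith
  have hpow : (1 - (2 * K)⁻¹ * lo) ^ Fintype.card ι ≤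
      Real.exp (-(Fintype.card ι * ((2 * K)⁻¹ * lo))) := by
    rw [← mul_neg, Real.exp_nat_mul]
    exact pow_le_pow_left₀ hfac (by linarith [Real.add_one_le_exp (-((2 * K)⁻¹ * lo))]) _
  have hreal : P.real {ω | Real.exp (-(K⁻¹ * a)) ≤ E ω} ≤
      Fintype.card m * Real.exp (-(Fintype.card ι * lo / (4 * K))) := by
    have h1 : Real.exp (-(K⁻¹ * a)) * P.real {ω | Real.exp (-(K⁻¹ * a)) ≤ E ω} ≤
        Fintype.card m * Real.exp (-(Fintype.card ι * ((2 * K)⁻¹ * lo))) :=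
      hmk.trans (hint.trans (by gcongr))
    -- The mean decays at exponent `n lo / (2K)` and the threshold at half that, since the cutoff is
    -- `lo / 4`. Markov's inequality keeps the other half.
    have h2 : Real.exp (-(Fintype.card ι * ((2 * K)⁻¹ * lo))) =
        Real.exp (-(K⁻¹ * a)) * Real.exp (-(Fintype.card ι * lo / (4 * K))) := by
      rw [← Real.exp_add, ha]; congr 1; field_simp; ring
    rw [h2] at h1
    exact le_of_mul_le_mul_left (h1.trans_eq (mul_left_comm _ _ _)) (Real.exp_pos _)
  calc _ ≤ P {ω | Real.exp (-(K⁻¹ * a)) ≤ E ω} := measure_mono hsub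
    _ = ENNReal.ofReal (P.real {ω | Real.exp (-(K⁻¹ * a)) ≤ E ω}) := by
      rw [ofReal_measureReal]
    _ ≤ _ := ENNReal.ofReal_le_ofReal hreal

end GramTail

/-! ### Elementary lemmas on quadratic minimization and second moments -/

theorem eq_zero_of_forall_quadratic_nonneg {a b : ℝ} (h : ∀ t : ℝ, 0 ≤ -(2 * t * a) + t ^ 2 * b) :
    a = 0 := by
  by_contra ha
  have hb : 0 ≤ b := by
    have h1 := h 1
    have h2 := h (-1)
    linarith
  -- Dividing by `b + 1` rather than by `b` also covers `b = 0`.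
  have h1 := h (a / (b + 1))
  have e : -(2 * (a / (b + 1)) * a) + (a / (b + 1)) ^ 2 * b =
      -(a ^ 2 * (b + 2) / (b + 1) ^ 2) := by
    field_simp; ring
  rw [e] at h1
  have : 0 < a ^ 2 * (b + 2) / (b + 1) ^ 2 := by positivity
  linarith

theorem integral_mul_eq_zero_of_forall_le {α : Type*} [MeasurableSpace α] {μ : Measure α}
    {r q : α → ℝ} (hr : MemLp r 2 μ) (hq : MemLp q 2 μ)
    (h : ∀ t : ℝ, ∫ a, r a ^ 2 ∂μ ≤ ∫ a, (r a - t * q a) ^ 2 ∂μ) : ∫ a, r a * q a ∂μ = 0 := by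
  have hrq : Integrable (fun a => r a * q a) μ := hr.integrable_mul hq
  refine eq_zero_of_forall_quadratic_nonneg (b := ∫ a, q a ^ 2 ∂μ) fun t => ?_
  have e : ∫ a, (r a - t * q a) ^ 2 ∂μ =
      ∫ a, r a ^ 2 ∂μ - 2 * t * ∫ a, r a * q a ∂μ + t ^ 2 * ∫ a, q a ^ 2 ∂μ := by
    have h1 : Integrable (fun a => r a ^ 2 - 2 * t * (r a * q a)) μ :=
      hr.integrable_sq.sub (hrq.const_mul _)
    rw [← integral_const_mul, ← integral_const_mul, ← integral_sub hr.integrable_sq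
      (hrq.const_mul _), ← integral_add h1 (hq.integrable_sq.const_mul _)]
    exact integral_congr_ae (ae_of_all _ fun a => by simp only; ring)
  have := h t
  rw [e] at this
  linarith

/-- Markov's inequality; the strict inequality in the event keeps it true when `A = 0`. -/
theorem measure_mul_lt_le {Ω : Type*} [MeasurableSpace Ω] {P : Measure Ω} [IsFiniteMeasure P]
    {f : Ω → ℝ} (hf : Integrable f P) (hf0 : ∀ ω, 0 ≤ f ω) {A T : ℝ} (hA : ∫ ω, f ω ∂P ≤ A)
    (hT : 0 < T) : P {ω | T * A < f ω} ≤ ENNReal.ofReal T⁻¹ := by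
  have hA0 : 0 ≤ A := (integral_nonneg hf0).trans hA
  rcases hA0.eq_or_lt with h0 | h0
  · have h1 : ∫ ω, f ω ∂P = 0 := le_antisymm (h0 ▸ hA) (integral_nonneg hf0)
    have h2 := (integral_eq_zero_iff_of_nonneg hf0 hf).1 h1
    have : P {ω | T * A < f ω} = 0 := by
      refine measure_mono_null (fun ω hω => ?_) (ae_iff.1 h2)
      simp only [Set.mem_ofPred_eq, ← h0, mul_zero] at hω
      exact hω.ne'
    rw [this]; exact zero_le
  · have h1 := mul_meas_ge_le_integral_of_nonneg (ae_of_all _ hf0) hf (T * A)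
    have h2 : P.real {ω | T * A ≤ f ω} ≤ T⁻¹ := by
      refine le_of_mul_le_mul_left ?_ (mul_pos hT h0)
      rw [mul_right_comm T A T⁻¹, mul_inv_cancel₀ hT.ne', one_mul]
      exact h1.trans hA
    calc P {ω | T * A < f ω} ≤ P {ω | T * A ≤ f ω} := measure_mono fun ω hω => by
          rw [Set.mem_ofPred_eq] at hω ⊢; exact hω.le
      _ = ENNReal.ofReal (P.real {ω | T * A ≤ f ω}) := by rw [ofReal_measureReal]
      _ ≤ _ := ENNReal.ofReal_le_ofReal h2

/-- Pythagoras for independent centred vectors, by additivity of variance in each coordinate. -/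
theorem integral_norm_sum_sq_eq {Ω S : Type*} [MeasurableSpace Ω] [MeasurableSpace S]
    {P : Measure Ω} [IsProbabilityMeasure P] {n k : ℕ} {Y : Fin n → Ω → S}
    (hind : iIndepFun Y P) {V : S → EuclideanSpace ℝ (Fin k)}
    (hV : Measurable V) (hL2 : ∀ i a, MemLp (fun ω => V (Y i ω) a) 2 P)
    (hmean : ∀ i a, ∫ ω, V (Y i ω) a ∂P = 0) :
    Integrable (fun ω => ‖∑ i, V (Y i ω)‖ ^ 2) P ∧
      ∫ ω, ‖∑ i, V (Y i ω)‖ ^ 2 ∂P = ∑ i, ∫ ω, ‖V (Y i ω)‖ ^ 2 ∂P := by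
  have hVa : ∀ a, Measurable fun s => V s a := fun a => by fun_prop
  have hsum : ∀ a, MemLp (fun ω => ∑ i, V (Y i ω) a) 2 P := fun a =>
    memLp_finsetSum _ fun i _ => hL2 i a
  have hcoord : ∀ a, ∫ ω, (∑ i, V (Y i ω) a) ^ 2 ∂P = ∑ i, ∫ ω, V (Y i ω) a ^ 2 ∂P := by
    intro a
    have hv := IndepFun.variance_sum (X := fun i ω => V (Y i ω) a) (s := Finset.univ) (μ := P)
      (fun i _ => hL2 i a) (fun i _ j _ hij => (hind.indepFun hij).comp (hVa a) (hVa a))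
    have e : (∑ i, fun ω => V (Y i ω) a) = fun ω => ∑ i, V (Y i ω) a := by
      funext ω; simp
    rw [e, variance_of_integral_eq_zero (hsum a).aemeasurable (by
      rw [integral_finsetSum _ fun i _ => (hL2 i a).integrable one_le_two]
      simp [hmean])] at hv
    rw [hv]
    exact Finset.sum_congr rfl fun i _ =>
      variance_of_integral_eq_zero (hL2 i a).aemeasurable (hmean i a)
  have e1 : ∀ ω, ‖∑ i, V (Y i ω)‖ ^ 2 = ∑ a, (∑ i, V (Y i ω) a) ^ 2 := fun ω => by
    rw [EuclideanSpace.real_norm_sq_eq]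
    simp
  simp only [e1, EuclideanSpace.real_norm_sq_eq]
  refine ⟨integrable_finsetSum _ fun a _ => (hsum a).integrable_sq, ?_⟩
  rw [integral_finsetSum _ fun a _ => (hsum a).integrable_sq]
  simp only [hcoord]
  rw [Finset.sum_comm]
  exact Finset.sum_congr rfl fun i _ =>
    (integral_finsetSum _ fun a _ => (hL2 i a).integrable_sq).symm

/-! ### Gram matrix -/

section Gram

open Matrix

variable {d k : ℕ} {F : Measure (EuclideanSpace ℝ (Fin d))}
  {p : EuclideanSpace ℝ (Fin d) → EuclideanSpace ℝ (Fin k)}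

theorem seriesFn_eq_dotProduct (b : EuclideanSpace ℝ (Fin k)) (z : EuclideanSpace ℝ (Fin d)) :
    seriesFn p b z = (p z).ofLp ⬝ᵥ b.ofLp := by
  rw [seriesFn, EuclideanSpace.inner_eq_star_dotProduct, dotProduct_comm]
  simp

theorem norm_sq_eq_dotProduct (v : EuclideanSpace ℝ (Fin k)) : ‖v‖ ^ 2 = v.ofLp ⬝ᵥ v.ofLp := by
  rw [EuclideanSpace.real_norm_sq_eq]
  simp [dotProduct, pow_two]

theorem abs_apply_le_norm (v : EuclideanSpace ℝ (Fin k)) (a : Fin k) : |v a| ≤ ‖v‖ := by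
  simpa using PiLp.norm_apply_le v a

theorem memLp_top_apply (hp : Measurable p) {K : ℝ} (hK : ∀ᵐ z ∂F, ‖p z‖ ≤ K) (a : Fin k) :
    MemLp (fun z => p z a) ⊤ F :=
  memLp_top_of_bound (Measurable.aestronglyMeasurable (by fun_prop)) K (by
    filter_upwards [hK] with z hz
    exact (abs_apply_le_norm _ _).trans hz)

theorem isHermitian_gramMatrix : (gramMatrix F p).IsHermitian := by
  ext a b
  simp [gramMatrix, mul_comm]

theorem measurable_seriesFn (hp : Measurable p) (b : EuclideanSpace ℝ (Fin k)) :
    Measurable (seriesFn p b) := by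
  unfold seriesFn; fun_prop

theorem memLp_top_seriesFn (hp : Measurable p) {K : ℝ} (hK : ∀ᵐ z ∂F, ‖p z‖ ≤ K)
    (b : EuclideanSpace ℝ (Fin k)) : MemLp (seriesFn p b) ⊤ F :=
  memLp_top_of_bound (measurable_seriesFn hp b).aestronglyMeasurable (K * ‖b‖) (by
    filter_upwards [hK] with z hz
    exact (norm_inner_le_norm _ _).trans (by gcongr))

theorem dotProduct_gramMatrix_mulVec [IsFiniteMeasure F] (hp : Measurable p) {K : ℝ}
    (hK : ∀ᵐ z ∂F, ‖p z‖ ≤ K) (v : EuclideanSpace ℝ (Fin k)) :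
    v.ofLp ⬝ᵥ gramMatrix F p *ᵥ v.ofLp = ∫ z, seriesFn p v z ^ 2 ∂F := by
  have hint : ∀ a b, Integrable (fun z => p z a * p z b) F := fun a b =>
    MemLp.integrable_mul (p := 2) (q := 2) ((memLp_top_apply hp hK a).mono_exponent le_top)
      ((memLp_top_apply hp hK b).mono_exponent le_top)
  have e : ∀ z, seriesFn p v z ^ 2 = ∑ a, ∑ b, v a * (p z a * p z b * v b) := fun z => by
    rw [seriesFn_eq_dotProduct, pow_two]
    simp only [dotProduct, Finset.sum_mul_sum]
    exact Finset.sum_congr rfl fun a _ => Finset.sum_congr rfl fun b _ => by ring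
  simp only [e]
  rw [integral_finsetSum _ fun a _ => integrable_finsetSum _ fun b _ =>
    ((hint a b).mul_const _).const_mul _]
  simp only [dotProduct, mulVec, gramMatrix, Finset.mul_sum, of_apply]
  refine Finset.sum_congr rfl fun a _ => ?_
  rw [integral_finsetSum _ fun b _ => ((hint a b).mul_const _).const_mul _]
  exact Finset.sum_congr rfl fun b _ => by rw [integral_const_mul, integral_mul_const]

theorem hasEigenvalue_gramMatrix (i : Fin k) : Module.End.HasEigenvalue
    (Matrix.toLin' (gramMatrix F p)) ((isHermitian_gramMatrix (F := F) (p := p)).eigenvalues i) := by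
  have h := (isHermitian_gramMatrix (F := F) (p := p)).eigenvalues_mem_spectrum_real i
  rw [← Matrix.spectrum_toLin'] at h
  exact Module.End.hasEigenvalue_iff_mem_spectrum.2 h

theorem EigenvaluesIn.le_dotProduct {lo hi : ℝ} (h : EigenvaluesIn F p lo hi) (v : Fin k → ℝ) :
    lo * (v ⬝ᵥ v) ≤ v ⬝ᵥ gramMatrix F p *ᵥ v :=
  isHermitian_gramMatrix.le_dotProduct_mulVec (fun i => (h _ (hasEigenvalue_gramMatrix i)).1) v

theorem EigenvaluesIn.dotProduct_le {lo hi : ℝ} (h : EigenvaluesIn F p lo hi) (v : Fin k → ℝ) :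
    v ⬝ᵥ gramMatrix F p *ᵥ v ≤ hi * (v ⬝ᵥ v) :=
  isHermitian_gramMatrix.dotProduct_mulVec_le (fun i => (h _ (hasEigenvalue_gramMatrix i)).2) v

theorem trace_gramMatrix [IsFiniteMeasure F] (hp : Measurable p) {K : ℝ}
    (hK : ∀ᵐ z ∂F, ‖p z‖ ≤ K) : ∫ z, ‖p z‖ ^ 2 ∂F = (gramMatrix F p).trace := by
  simp only [EuclideanSpace.real_norm_sq_eq, trace, diag_apply, gramMatrix, of_apply]
  rw [integral_finsetSum _ fun a _ =>
    ((memLp_top_apply hp hK a).mono_exponent (p := 2) le_top).integrable_sq]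
  simp [pow_two]

theorem EigenvaluesIn.le_diag {lo hi : ℝ} (h : EigenvaluesIn F p lo hi) (a : Fin k) :
    lo ≤ gramMatrix F p a a ∧ gramMatrix F p a a ≤ hi := by
  have h1 := h.le_dotProduct (Pi.single a 1)
  have h2 := h.dotProduct_le (Pi.single a 1)
  simp at h1 h2
  exact ⟨h1, h2⟩

theorem EigenvaluesIn.integral_norm_sq_mem [IsFiniteMeasure F] {lo hi : ℝ}
    (h : EigenvaluesIn F p lo hi) (hp : Measurable p) {K : ℝ} (hK : ∀ᵐ z ∂F, ‖p z‖ ≤ K) :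
    k * lo ≤ ∫ z, ‖p z‖ ^ 2 ∂F ∧ ∫ z, ‖p z‖ ^ 2 ∂F ≤ k * hi := by
  rw [trace_gramMatrix hp hK, trace]
  constructor
  · simpa using Finset.sum_le_sum fun (a : Fin k) (_ : a ∈ Finset.univ) => (h.le_diag a).1
  · simpa using Finset.sum_le_sum fun (a : Fin k) (_ : a ∈ Finset.univ) => (h.le_diag a).2

end Gram

/-! ### Moments of a regression sample -/

section Sample

variable {Ω : Type*} [MeasurableSpace Ω] {d n k : ℕ} {P : Measure Ω} [IsProbabilityMeasure P]
  {X : Set (EuclideanSpace ℝ (Fin d))} {F : Measure (EuclideanSpace ℝ (Fin d))}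
  {g : EuclideanSpace ℝ (Fin d) → ℝ}
  {y : Fin n → Ω → ℝ} {x : Fin n → Ω → EuclideanSpace ℝ (Fin d)}
  {p : EuclideanSpace ℝ (Fin d) → EuclideanSpace ℝ (Fin k)}
  {G : Set (EuclideanSpace ℝ (Fin d) → ℝ)} {β : EuclideanSpace ℝ (Fin k)} {c l C : ℝ}

theorem norm_le_xiSup (hb : BddAbove ((fun z => ‖p z‖) '' X)) {z : EuclideanSpace ℝ (Fin d)}
    (hz : z ∈ X) : ‖p z‖ ≤ xiSup X p :=
  le_csSup hb ⟨z, hz, rfl⟩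

theorem xiSup_nonneg : 0 ≤ xiSup X p :=
  Real.sSup_nonneg (by rintro _ ⟨z, _, rfl⟩; exact norm_nonneg _)

namespace IsRegressionSample

omit [IsProbabilityMeasure P] in
theorem ae_of_forall_mem (h : IsRegressionSample P X F g y x) (i : Fin n)
    {q : EuclideanSpace ℝ (Fin d) → Prop} (hq : MeasurableSet {z | q z}) (hX : ∀ z ∈ X, q z) :
    ∀ᵐ z ∂F, q z := by
  rw [← h.law i, ae_map_iff (h.measurable_x i).aemeasurable hq]
  filter_upwards [h.mem i] with ω hω using hX _ hω

theorem isProbabilityMeasure_law (h : IsRegressionSample P X F g y x) (i : Fin n) :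
    IsProbabilityMeasure F := by
  rw [← h.law i]
  exact Measure.isProbabilityMeasure_map (h.measurable_x i).aemeasurable

omit [IsProbabilityMeasure P] in
theorem measurePreserving (h : IsRegressionSample P X F g y x) (i : Fin n) :
    MeasurePreserving (x i) P F :=
  ⟨h.measurable_x i, h.law i⟩

omit [IsProbabilityMeasure P] in
theorem ae_norm_le (h : IsRegressionSample P X F g y x) (i : Fin n) (hp : Measurable p)
    (hb : BddAbove ((fun z => ‖p z‖) '' X)) : ∀ᵐ z ∂F, ‖p z‖ ≤ xiSup X p :=
  h.ae_of_forall_mem i (measurableSet_le hp.norm measurable_const) fun _ hz => norm_le_xiSup hb hz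

/-- If `g` were not in `L²`, each projection objective would be a non-integrable integral, hence `0`
by convention. Then `b = 0` would count as a projection coefficient, and the bound at `b = 0` would
put `g` in `L²` after all. -/
theorem memLp_of_approxBound (h : IsRegressionSample P X F g y x) (i : Fin n) (hp : Measurable p)
    (hb : BddAbove ((fun z => ‖p z‖) '' X)) (hg : Measurable g) (hgG : g ∈ G)
    (hA : ApproxBound X F p G c l) : MemLp g 2 F := by
  have := h.isProbabilityMeasure_law i
  have hser : ∀ b, MemLp (seriesFn p b) 2 F := fun b =>
    (memLp_top_seriesFn hp (h.ae_norm_le i hp hb) b).mono_exponent le_top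
  by_contra hcon
  have hzero : ∀ b, ∫ z, (g z - seriesFn p b z) ^ 2 ∂F = 0 := fun b => by
    refine integral_undef fun hint => hcon ?_
    have h1 : MemLp (fun z => g z - seriesFn p b z) 2 F :=
      (memLp_two_iff_integrable_sq
        (hg.sub (measurable_seriesFn hp b)).aestronglyMeasurable).2 hint
    have e : (fun z => g z - seriesFn p b z) + seriesFn p b = g := by funext z; simp
    exact e ▸ h1.add (hser b)
  have hproj : IsProjCoef F p g 0 := fun b _ => by simp [hzero]
  have h1 : MemLp (g - seriesFn p 0) 2 F :=
    ⟨(hg.sub (measurable_seriesFn hp 0)).aestronglyMeasurable,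
      ((hA.2 g hgG 0 hproj).1).trans_lt ENNReal.ofReal_lt_top⟩
  exact hcon (by simpa using h1.add (hser 0))

theorem integral_comp_mul_err (h : IsRegressionSample P X F g y x) (i : Fin n)
    {q : EuclideanSpace ℝ (Fin d) → ℝ} (hq : Measurable q)
    (hint : Integrable (fun ω => q (x i ω) * regErr y x g i ω) P) :
    ∫ ω, q (x i ω) * regErr y x g i ω ∂P = 0 := by
  have hm : sigmaOf (x i) ≤ ‹MeasurableSpace Ω› := (h.measurable_x i).comap_le
  have hqm : StronglyMeasurable[sigmaOf (x i)] fun ω => q (x i ω) :=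
    (hq.comp (comap_measurable (x i))).stronglyMeasurable
  have h1 := condExp_mul_of_stronglyMeasurable_left hqm hint (h.integrable_err i)
  rw [← integral_condExp hm]
  refine integral_eq_zero_of_ae (h1.trans ?_)
  filter_upwards [h.condExp_err i] with ω hω
  simp [hω]

omit [IsProbabilityMeasure P] in
theorem memLp_err (h : IsRegressionSample P X F g y x) (hC : CondVarLE P g y x C) (i : Fin n) :
    MemLp (regErr y x g i) 2 P :=
  (memLp_two_iff_integrable_sq (h.integrable_err i).aestronglyMeasurable).2 (hC i).1

theorem integral_comp_mul_err_sq_le (h : IsRegressionSample P X F g y x)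
    (hC : CondVarLE P g y x C) (i : Fin n)
    {q : EuclideanSpace ℝ (Fin d) → ℝ} (hq : Measurable q) (hq0 : ∀ z, 0 ≤ q z) {B : ℝ}
    (hqB : ∀ᵐ z ∂F, q z ≤ B) :
    Integrable (fun ω => q (x i ω) * regErr y x g i ω ^ 2) P ∧
    ∫ ω, q (x i ω) * regErr y x g i ω ^ 2 ∂P ≤ C * ∫ z, q z ∂F := by
  have := h.isProbabilityMeasure_law i
  have hm : sigmaOf (x i) ≤ ‹MeasurableSpace Ω› := (h.measurable_x i).comap_le
  have hqm : StronglyMeasurable[sigmaOf (x i)] fun ω => q (x i ω) :=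
    (hq.comp (comap_measurable (x i))).stronglyMeasurable
  have hqF : Integrable q F := Integrable.of_bound hq.aestronglyMeasurable B (by
    filter_upwards [hqB] with z hz
    rwa [Real.norm_of_nonneg (hq0 z)])
  have hqP : Integrable (fun ω => q (x i ω)) P :=
    (h.measurePreserving i).integrable_comp_of_integrable hqF
  have hint : Integrable (fun ω => q (x i ω) * regErr y x g i ω ^ 2) P := by
    refine (hC i).1.bdd_mul (c := B) (hqm.mono hm).aestronglyMeasurable ?_
    filter_upwards [(h.measurePreserving i).quasiMeasurePreserving.ae hqB] with ω hω
    rwa [Real.norm_of_nonneg (hq0 _)]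
  refine ⟨hint, ?_⟩
  have h1 := condExp_mul_of_stronglyMeasurable_left hqm hint (hC i).1
  have e : ∫ z, q z ∂F = ∫ ω, q (x i ω) ∂P := by
    rw [← h.law i, integral_map (h.measurable_x i).aemeasurable
      (by rw [h.law i]; exact hq.aestronglyMeasurable)]
  rw [← integral_condExp hm, e, ← integral_const_mul]
  refine integral_mono_ae integrable_condExp (hqP.const_mul _) ?_
  filter_upwards [h1, (hC i).2] with ω hω1 hω2
  refine (show _ ≤ _ from hω1.le).trans ?_
  rw [Pi.mul_apply, mul_comm C]
  exact mul_le_mul_of_nonneg_left hω2 (hq0 _)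

/-- Since `ε` is orthogonal to functions of `x`, the two objectives differ by the constant `E ε²`.
This makes the approximation bounds available at `β`. -/
theorem isProjCoef_of_isLSParam (h : IsRegressionSample P X F g y x) (i : Fin n)
    (hp : Measurable p) (hb : BddAbove ((fun z => ‖p z‖) '' X)) (hgm : Measurable g)
    (hg : MemLp g 2 F) (hC : CondVarLE P g y x C) (hβ : IsLSParam P p y x β) :
    IsProjCoef F p g β := by
  have := h.isProbabilityMeasure_law i
  have hser : ∀ b, MemLp (seriesFn p b) 2 F := fun b =>
    (memLp_top_seriesFn hp (h.ae_norm_le i hp hb) b).mono_exponent le_top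
  have hε := h.memLp_err hC i
  have e : ∀ b, ∫ ω, (y i ω - seriesFn p b (x i ω)) ^ 2 ∂P =
      ∫ ω, regErr y x g i ω ^ 2 ∂P + ∫ z, (g z - seriesFn p b z) ^ 2 ∂F := by
    intro b
    have hr : MemLp (fun z => g z - seriesFn p b z) 2 F := hg.sub (hser b)
    have hrP : MemLp (fun ω => g (x i ω) - seriesFn p b (x i ω)) 2 P :=
      hr.comp_measurePreserving (h.measurePreserving i)
    have hm : Measurable fun z => g z - seriesFn p b z := hgm.sub (measurable_seriesFn hp b)
    have hcross : Integrable (fun ω => (g (x i ω) - seriesFn p b (x i ω)) * regErr y x g i ω) P :=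
      hrP.integrable_mul hε
    have h0 := h.integral_comp_mul_err i hm hcross
    have eF : ∫ z, (g z - seriesFn p b z) ^ 2 ∂F =
        ∫ ω, (g (x i ω) - seriesFn p b (x i ω)) ^ 2 ∂P := by
      rw [← h.law i, integral_map (h.measurable_x i).aemeasurable
        (hm.pow_const 2).aestronglyMeasurable]
    have h1 : Integrable (fun ω => regErr y x g i ω ^ 2 +
        2 * ((g (x i ω) - seriesFn p b (x i ω)) * regErr y x g i ω)) P :=
      (hC i).1.add (hcross.const_mul 2)
    rw [eF, ← integral_add (hC i).1 hrP.integrable_sq]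
    have h2 := integral_add h1 hrP.integrable_sq
    rw [integral_add (hC i).1 (hcross.const_mul 2), integral_const_mul, h0, mul_zero, add_zero,
      ← integral_add (hC i).1 hrP.integrable_sq] at h2
    rw [← h2]
    exact integral_congr_ae (ae_of_all _ fun ω => by simp only [regErr]; ring)
  intro b hb'
  have := hβ i hb'
  simp only [Set.mem_ofPred_eq, e] at this ⊢
  linarith

end IsRegressionSample

omit [IsProbabilityMeasure P] in
theorem integral_resid_mul_series_eq_zero [IsFiniteMeasure P] {i : Fin n}
    (hu : MemLp (fun ω => y i ω - seriesFn p β (x i ω)) 2 P)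
    (hs : ∀ b, MemLp (fun ω => seriesFn p b (x i ω)) 2 P)
    (hβ : IsLSParam P p y x β) (b : EuclideanSpace ℝ (Fin k)) :
    ∫ ω, (y i ω - seriesFn p β (x i ω)) * seriesFn p b (x i ω) ∂P = 0 := by
  refine integral_mul_eq_zero_of_forall_le hu (hs b) fun t => ?_
  have := hβ i (Set.mem_univ (β + t • b))
  rw [Set.mem_ofPred_eq] at this
  refine this.trans (le_of_eq (integral_congr_ae (ae_of_all _ fun ω => ?_)))
  simp only [seriesFn, inner_add_right, inner_smul_right]
  ring

theorem sum_resid_mul_series_eq_zero (hn : 0 < n) {y : Fin n → ℝ}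
    {x : Fin n → EuclideanSpace ℝ (Fin d)} (h : IsLSEstimate p y x β)
    (b : EuclideanSpace ℝ (Fin k)) :
    ∑ i, (y i - seriesFn p β (x i)) * seriesFn p b (x i) = 0 := by
  refine eq_zero_of_forall_quadratic_nonneg (b := ∑ i, seriesFn p b (x i) ^ 2) fun t => ?_
  have := h (Set.mem_univ (β + t • b))
  rw [Set.mem_ofPred_eq] at this
  have h' := le_of_mul_le_mul_left this (by positivity)
  have e : ∑ i, (y i - seriesFn p (β + t • b) (x i)) ^ 2 =
      ∑ i, (y i - seriesFn p β (x i)) ^ 2 -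
        2 * t * ∑ i, (y i - seriesFn p β (x i)) * seriesFn p b (x i) +
        t ^ 2 * ∑ i, seriesFn p b (x i) ^ 2 := by
    rw [Finset.mul_sum, Finset.mul_sum, ← Finset.sum_sub_distrib, ← Finset.sum_add_distrib]
    refine Finset.sum_congr rfl fun i _ => ?_
    simp only [seriesFn, inner_add_right, inner_smul_right]
    ring
  rw [e] at h'
  linarith

end Sample

/-! ### Bounds for the least squares estimator -/

theorem MeasureTheory.MemLp.eLpNorm_two_le_ofReal_iff {α : Type*} [MeasurableSpace α]
    {μ : Measure α} {f : α → ℝ} (hf : MemLp f 2 μ) {c : ℝ} (hc : 0 ≤ c) :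
    eLpNorm f 2 μ ≤ ENNReal.ofReal c ↔ ∫ a, f a ^ 2 ∂μ ≤ c ^ 2 := by
  rw [hf.eLpNorm_eq_integral_rpow_norm two_ne_zero ENNReal.ofNat_ne_top,
    ENNReal.ofReal_le_ofReal_iff hc]
  have e : ∫ a, ‖f a‖ ^ (2 : ℝ≥0∞).toReal ∂μ = ∫ a, f a ^ 2 ∂μ := by
    refine integral_congr_ae (ae_of_all _ fun a => ?_)
    simp
  rw [e, ENNReal.toReal_ofNat, ← one_div, ← Real.sqrt_eq_rpow, Real.sqrt_le_left hc]

section Estimator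

variable {Ω : Type*} [MeasurableSpace Ω] {d n k : ℕ} {P : Measure Ω} [IsProbabilityMeasure P]
  {X : Set (EuclideanSpace ℝ (Fin d))} {F : Measure (EuclideanSpace ℝ (Fin d))}
  {g : EuclideanSpace ℝ (Fin d) → ℝ}
  {y : Fin n → Ω → ℝ} {x : Fin n → Ω → EuclideanSpace ℝ (Fin d)}
  {p : EuclideanSpace ℝ (Fin d) → EuclideanSpace ℝ (Fin k)}
  {G : Set (EuclideanSpace ℝ (Fin d) → ℝ)} {β : EuclideanSpace ℝ (Fin k)} {c l C lo hi : ℝ}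

theorem eLpNorm_seriesFn_le [IsFiniteMeasure F] (hp : Measurable p) {K : ℝ}
    (hK : ∀ᵐ z ∂F, ‖p z‖ ≤ K) (hE : EigenvaluesIn F p lo hi) (hhi : 0 ≤ hi)
    (v : EuclideanSpace ℝ (Fin k)) :
    eLpNorm (seriesFn p v) 2 F ≤ ENNReal.ofReal (√hi * ‖v‖) := by
  rw [((memLp_top_seriesFn hp hK v).mono_exponent le_top).eLpNorm_two_le_ofReal_iff
    (by positivity), mul_pow, Real.sq_sqrt hhi, norm_sq_eq_dotProduct,
    ← dotProduct_gramMatrix_mulVec hp hK]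
  exact hE.dotProduct_le _

namespace IsRegressionSample

/-- Both sides bracket `tr Q = E ‖p‖²`. -/
theorem card_mul_le_xiSup_sq (h : IsRegressionSample P X F g y x) (hn : 0 < n)
    (hp : Measurable p) (hb : BddAbove ((fun z => ‖p z‖) '' X)) (hE : EigenvaluesIn F p lo hi) :
    k * lo ≤ xiSup X p ^ 2 := by
  have := h.isProbabilityMeasure_law ⟨0, hn⟩
  have hK := h.ae_norm_le ⟨0, hn⟩ hp hb
  refine (hE.integral_norm_sq_mem hp hK).1.trans ?_
  have : ∫ z, ‖p z‖ ^ 2 ∂F ≤ ∫ _, xiSup X p ^ 2 ∂F := by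
    refine integral_mono_ae (Integrable.of_bound (hp.norm.pow_const 2).aestronglyMeasurable
      (xiSup X p ^ 2) ?_) (integrable_const _) ?_
    · filter_upwards [hK] with z hz
      simp only [norm_pow, norm_norm]
      gcongr
    · filter_upwards [hK] with z hz
      gcongr
  simpa using this

theorem measure_gram_lt_le (h : IsRegressionSample P X F g y x) (hn : 0 < n)
    (hp : Measurable p) (hb : BddAbove ((fun z => ‖p z‖) '' X)) (hE : EigenvaluesIn F p lo hi)
    (hlo : 0 < lo) :
    P {ω | ∃ v, ∑ i, seriesFn p v (x i ω) ^ 2 < n * (lo / 4) * ‖v‖ ^ 2} ≤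
      ENNReal.ofReal (k * Real.exp (-(n * lo / (4 * xiSup X p ^ 2)))) := by
  have := h.isProbabilityMeasure_law ⟨0, hn⟩
  have hK := h.ae_norm_le ⟨0, hn⟩ hp hb
  rcases Nat.eq_zero_or_pos k with rfl | hk
  · refine (measure_mono_null (fun ω hω => ?_) measure_empty).le.trans zero_le
    obtain ⟨v, hv⟩ := hω
    rw [Subsingleton.elim v 0] at hv
    simp [seriesFn] at hv
  have hkK := h.card_mul_le_xiSup_sq hn hp hb hE
  have hk1 : (1 : ℝ) ≤ k := by exact_mod_cast hk
  have hloK : lo ≤ xiSup X p ^ 2 := by nlinarith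
  have hpz : Measurable fun z => (p z).ofLp := by fun_prop
  have := measure_exists_gram_lt_le (P := P) (z := fun i ω => (p (x i ω)).ofLp)
    (K := xiSup X p ^ 2) (lo := lo) (Q := gramMatrix F p)
    (fun i => hpz.comp (h.measurable_x i))
    (h.indep.comp (fun _ q => (p q.2).ofLp) fun _ => hpz.comp measurable_snd)
    (by linarith) (by linarith) (fun i => ?_) (fun i a b => ?_) (fun v => hE.le_dotProduct v)
  · refine le_trans (measure_mono ?_) (by simpa using this)
    rintro ω ⟨v, hv⟩
    refine ⟨v.ofLp, ?_⟩
    rw [norm_sq_eq_dotProduct] at hv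
    simpa only [seriesFn_eq_dotProduct] using hv
  · filter_upwards [(h.measurePreserving i).quasiMeasurePreserving.ae hK] with ω hω
    rw [← norm_sq_eq_dotProduct]
    gcongr
  · have hm : Measurable fun z => p z a * p z b := by fun_prop
    rw [gramMatrix, Matrix.of_apply, ← h.law i,
      integral_map (h.measurable_x i).aemeasurable hm.aestronglyMeasurable]

omit [IsProbabilityMeasure P] in
theorem memLp_mul_apply (h : IsRegressionSample P X F g y x) (i : Fin n) (hp : Measurable p)
    (hb : BddAbove ((fun z => ‖p z‖) '' X)) {w : Ω → ℝ} (hw : MemLp w 2 P) (a : Fin k) :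
    MemLp (fun ω => w ω * p (x i ω) a) 2 P :=
  MemLp.mul (p := 2) (q := ⊤) ((memLp_top_apply hp (h.ae_norm_le i hp hb) a).comp_measurePreserving
    (h.measurePreserving i)) hw

theorem integral_norm_sum_err_le (h : IsRegressionSample P X F g y x)
    (hp : Measurable p) (hb : BddAbove ((fun z => ‖p z‖) '' X)) (hg : Measurable g)
    (hC : CondVarLE P g y x C) :
    Integrable (fun ω => ‖∑ i, regErr y x g i ω • p (x i ω)‖ ^ 2) P ∧
    ∫ ω, ‖∑ i, regErr y x g i ω • p (x i ω)‖ ^ 2 ∂P ≤ n * (C * ∫ z, ‖p z‖ ^ 2 ∂F) := by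
  have hL2 : ∀ i a, MemLp (fun ω => regErr y x g i ω * p (x i ω) a) 2 P := fun i a =>
    h.memLp_mul_apply i hp hb (h.memLp_err hC i) a
  have := integral_norm_sum_sq_eq h.indep
    (V := fun q : ℝ × EuclideanSpace ℝ (Fin d) => (q.1 - g q.2) • p q.2) (by fun_prop)
    (fun i a => hL2 i a) (fun i a => by
      have h1 := h.integral_comp_mul_err i (q := fun z => p z a) (by fun_prop)
        (((hL2 i a).integrable one_le_two).congr (ae_of_all _ fun ω => mul_comm _ _))
      rw [← h1]
      exact integral_congr_ae (ae_of_all _ fun ω => by simp [regErr, mul_comm]))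
  refine ⟨this.1, this.2.le.trans ?_⟩
  have hi : ∀ i, ∫ ω, ‖(y i ω - g (x i ω)) • p (x i ω)‖ ^ 2 ∂P ≤ C * ∫ z, ‖p z‖ ^ 2 ∂F := by
    intro i
    refine le_trans (le_of_eq (integral_congr_ae (ae_of_all _ fun ω => ?_)))
      (h.integral_comp_mul_err_sq_le hC i (q := fun z => ‖p z‖ ^ 2) (by fun_prop)
        (fun z => by positivity) (B := xiSup X p ^ 2) ?_).2
    · simp only [norm_smul, mul_pow, regErr, Real.norm_eq_abs, sq_abs]
      ring
    · filter_upwards [h.ae_norm_le i hp hb] with z hz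
      gcongr
  simpa using Finset.sum_le_sum fun i (_ : i ∈ Finset.univ) => hi i

/-- The residual `ε + r` need not have conditional mean zero, but the first-order condition for `β`
makes its product with each `p_a` centred, which is all that additivity needs. The factor `2` comes
from `(ε + r)² ≤ 2ε² + 2r²`. -/
theorem integral_norm_sum_resid_le (h : IsRegressionSample P X F g y x)
    (hp : Measurable p) (hb : BddAbove ((fun z => ‖p z‖) '' X)) (hg : Measurable g)
    (hg2 : MemLp g 2 F) (hC : CondVarLE P g y x C) (hβ : IsLSParam P p y x β) {D : ℝ}
    (hD : ∫ z, ‖p z‖ ^ 2 * (g z - seriesFn p β z) ^ 2 ∂F ≤ D) :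
    Integrable (fun ω => ‖∑ i, (y i ω - seriesFn p β (x i ω)) • p (x i ω)‖ ^ 2) P ∧
    ∫ ω, ‖∑ i, (y i ω - seriesFn p β (x i ω)) • p (x i ω)‖ ^ 2 ∂P ≤
      n * (2 * (C * ∫ z, ‖p z‖ ^ 2 ∂F + D)) := by
  have hser := measurable_seriesFn hp β
  have hs : ∀ i b, MemLp (fun ω => seriesFn p b (x i ω)) 2 P := fun i b => by
    have := h.isProbabilityMeasure_law i
    exact ((memLp_top_seriesFn hp (h.ae_norm_le i hp hb) b).mono_exponent
      le_top).comp_measurePreserving (h.measurePreserving i)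
  have hr : ∀ i, MemLp (fun ω => g (x i ω) - seriesFn p β (x i ω)) 2 P := fun i =>
    (hg2.comp_measurePreserving (h.measurePreserving i)).sub (hs i β)
  have hu : ∀ i, MemLp (fun ω => y i ω - seriesFn p β (x i ω)) 2 P := fun i => by
    refine ((h.memLp_err hC i).add (hr i)).congr_norm
      ((h.measurable_y i).sub (hser.comp (h.measurable_x i))).aestronglyMeasurable
      (ae_of_all _ fun ω => ?_)
    simp [regErr]
  have := integral_norm_sum_sq_eq h.indep
    (V := fun q : ℝ × EuclideanSpace ℝ (Fin d) => (q.1 - seriesFn p β q.2) • p q.2) (by fun_prop)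
    (fun i a => h.memLp_mul_apply i hp hb (hu i) a) (fun i a => by
      have h1 := integral_resid_mul_series_eq_zero (hu i) (hs i) hβ (EuclideanSpace.single a 1)
      rw [← h1]
      refine integral_congr_ae (ae_of_all _ fun ω => ?_)
      simp [seriesFn_eq_dotProduct])
  refine ⟨this.1, this.2.le.trans ?_⟩
  have hi : ∀ i, ∫ ω, ‖(y i ω - seriesFn p β (x i ω)) • p (x i ω)‖ ^ 2 ∂P ≤
      2 * (C * ∫ z, ‖p z‖ ^ 2 ∂F + D) := by
    intro i
    have hK := h.ae_norm_le i hp hb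
    obtain ⟨hi1, hi2⟩ := h.integral_comp_mul_err_sq_le hC i (q := fun z => ‖p z‖ ^ 2) (by fun_prop)
        (fun z => by positivity) (B := xiSup X p ^ 2) (by
          filter_upwards [hK] with z hz
          gcongr)
    have hrm : Measurable fun z => ‖p z‖ ^ 2 * (g z - seriesFn p β z) ^ 2 := by fun_prop
    have hrint : Integrable (fun ω => ‖p (x i ω)‖ ^ 2 * (g (x i ω) - seriesFn p β (x i ω)) ^ 2)
        P := by
      refine (hr i).integrable_sq.bdd_mul (c := xiSup X p ^ 2)
        ((hp.norm.pow_const 2).comp (h.measurable_x i)).aestronglyMeasurable ?_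
      filter_upwards [(h.measurePreserving i).quasiMeasurePreserving.ae hK] with ω hω
      simp only [norm_pow, norm_norm]
      gcongr
    rw [← h.law i, integral_map (h.measurable_x i).aemeasurable hrm.aestronglyMeasurable] at hD
    have hsum : ∫ ω, 2 * (‖p (x i ω)‖ ^ 2 * regErr y x g i ω ^ 2 +
        ‖p (x i ω)‖ ^ 2 * (g (x i ω) - seriesFn p β (x i ω)) ^ 2) ∂P ≤
        2 * (C * ∫ z, ‖p z‖ ^ 2 ∂F + D) := by
      rw [integral_const_mul, integral_add hi1 hrint]
      gcongr
    refine le_trans (integral_mono_of_nonneg (ae_of_all _ fun ω => by positivity)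
      ((hi1.add hrint).const_mul 2) (ae_of_all _ fun ω => ?_)) hsum
    simp only [norm_smul, mul_pow, regErr, Real.norm_eq_abs, sq_abs, Pi.add_apply]
    nlinarith [mul_nonneg (sq_nonneg ‖p (x i ω)‖)
      (sq_nonneg ((y i ω - g (x i ω)) - (g (x i ω) - seriesFn p β (x i ω))))]
  simpa using Finset.sum_le_sum fun i (_ : i ∈ Finset.univ) => hi i

end IsRegressionSample

theorem sum_mul_seriesFn (w : Fin n → ℝ) (x : Fin n → EuclideanSpace ℝ (Fin d))
    (v : EuclideanSpace ℝ (Fin k)) :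
    ∑ i, w i * seriesFn p v (x i) = inner ℝ (∑ i, w i • p (x i)) v := by
  simp only [sum_inner, inner_smul_left, seriesFn]
  rfl

theorem IsLSEstimate.sum_sq_eq (hn : 0 < n) {y : Fin n → ℝ}
    {x : Fin n → EuclideanSpace ℝ (Fin d)} {b : EuclideanSpace ℝ (Fin k)}
    (h : IsLSEstimate p y x b) (β : EuclideanSpace ℝ (Fin k)) :
    ∑ i, seriesFn p (b - β) (x i) ^ 2 =
      ∑ i, (y i - seriesFn p β (x i)) * seriesFn p (b - β) (x i) := by
  have h0 := sum_resid_mul_series_eq_zero hn h (b - β)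
  rw [← sub_eq_zero, ← neg_eq_zero, neg_sub, ← Finset.sum_sub_distrib, ← h0]
  refine Finset.sum_congr rfl fun i _ => ?_
  simp only [seriesFn, inner_sub_right]
  ring

theorem IsLSEstimate.norm_sub_sq_le (hn : 0 < n) {y : Fin n → ℝ}
    {x : Fin n → EuclideanSpace ℝ (Fin d)} {b : EuclideanSpace ℝ (Fin k)}
    (h : IsLSEstimate p y x b) (β : EuclideanSpace ℝ (Fin k)) (hlo : 0 < lo)
    (hgood : ∀ v, n * (lo / 4) * ‖v‖ ^ 2 ≤ ∑ i, seriesFn p v (x i) ^ 2) :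
    ‖b - β‖ ^ 2 ≤ 16 / (n * lo) ^ 2 * ‖∑ i, (y i - seriesFn p β (x i)) • p (x i)‖ ^ 2 := by
  have h1 := hgood (b - β)
  rw [h.sum_sq_eq hn β, sum_mul_seriesFn] at h1
  have h2 := h1.trans (real_inner_le_norm _ _)
  set D := ‖b - β‖
  set W := ‖∑ i, (y i - seriesFn p β (x i)) • p (x i)‖
  have hD : 0 ≤ D := norm_nonneg _
  have hW : 0 ≤ W := norm_nonneg _
  have ha : 0 < n * lo := by positivity
  have h3 : n * lo * D ≤ 4 * W := by
    rcases hD.eq_or_lt with h0 | h0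
    · rw [← h0]; linarith
    · refine le_of_mul_le_mul_right ?_ h0
      nlinarith
  rw [div_mul_eq_mul_div, le_div_iff₀ (by positivity)]
  nlinarith [mul_self_le_mul_self (by positivity) h3]

/-- Young's inequality absorbs the contribution of `g - p'β` into half of the empirical form; a
second use of it absorbs the linear term `‖W‖ ‖Δ‖`. -/
theorem IsLSEstimate.norm_sub_sq_le_add (hn : 0 < n) {y : Fin n → ℝ}
    {x : Fin n → EuclideanSpace ℝ (Fin d)} {b : EuclideanSpace ℝ (Fin k)}
    (h : IsLSEstimate p y x b) (β : EuclideanSpace ℝ (Fin k))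
    (g : EuclideanSpace ℝ (Fin d) → ℝ) (hlo : 0 < lo)
    (hgood : ∀ v, n * (lo / 4) * ‖v‖ ^ 2 ≤ ∑ i, seriesFn p v (x i) ^ 2) :
    ‖b - β‖ ^ 2 ≤ 64 / (n * lo) ^ 2 * ‖∑ i, (y i - g (x i)) • p (x i)‖ ^ 2 +
      8 / (n * lo) * ∑ i, (g (x i) - seriesFn p β (x i)) ^ 2 := by
  have h1 := hgood (b - β)
  have h2 := h.sum_sq_eq hn β
  set S := ∑ i, seriesFn p (b - β) (x i) ^ 2
  set R := ∑ i, (g (x i) - seriesFn p β (x i)) ^ 2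
  have h3 : S ≤ inner ℝ (∑ i, (y i - g (x i)) • p (x i)) (b - β) + (R / 2 + S / 2) := by
    rw [← sum_mul_seriesFn]
    refine h2.trans_le ?_
    simp only [S, R, Finset.sum_div, ← Finset.sum_add_distrib]
    refine Finset.sum_le_sum fun i _ => ?_
    nlinarith [sq_nonneg (g (x i) - seriesFn p β (x i) - seriesFn p (b - β) (x i))]
  have h4 := real_inner_le_norm (∑ i, (y i - g (x i)) • p (x i)) (b - β)
  set D := ‖b - β‖
  set W := ‖∑ i, (y i - g (x i)) • p (x i)‖
  have ha : 0 < n * lo := by positivity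
  set a := n * lo
  have h5 : a / 4 * D ^ 2 ≤ 2 * (W * D) + R := by
    have : n * (lo / 4) * D ^ 2 = a / 4 * D ^ 2 := by simp only [a]; ring
    linarith
  have h6 : a ^ 2 * D ^ 2 ≤ 64 * W ^ 2 + 8 * a * R := by
    nlinarith [sq_nonneg (a * D - 8 * W)]
  have e : 64 / a ^ 2 * W ^ 2 + 8 / a * R = (64 * W ^ 2 + 8 * a * R) / a ^ 2 := by
    field_simp
  rw [e, le_div_iff₀ (by positivity)]
  linarith

end Estimator

/-! ### Tail bounds and rates -/

section Tail

variable {Ω : Type*} [MeasurableSpace Ω] {d n k : ℕ} {P : Measure Ω} [IsProbabilityMeasure P]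
  {X : Set (EuclideanSpace ℝ (Fin d))} {F : Measure (EuclideanSpace ℝ (Fin d))}
  {g : EuclideanSpace ℝ (Fin d) → ℝ}
  {y : Fin n → Ω → ℝ} {x : Fin n → Ω → EuclideanSpace ℝ (Fin d)}
  {p : EuclideanSpace ℝ (Fin d) → EuclideanSpace ℝ (Fin k)}
  {G : Set (EuclideanSpace ℝ (Fin d) → ℝ)} {β : EuclideanSpace ℝ (Fin k)} {c l C lo hi : ℝ}
  {βhat : Ω → EuclideanSpace ℝ (Fin k)}

theorem measure_correct_tail_le (h : IsRegressionSample P X F g y x) (hn : 0 < n)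
    (hp : Measurable p) (hb : BddAbove ((fun z => ‖p z‖) '' X)) (hg : Measurable g) (hgG : g ∈ G)
    (hE : EigenvaluesIn F p lo hi) (hlo : 0 < lo) (hhi : 0 ≤ hi) (hA : ApproxBound X F p G c l)
    (hC : CondVarLE P g y x C) (hC0 : 0 ≤ C) (hβ : IsLSParam P p y x β)
    (hβhat : ∀ ω, IsLSEstimate p (fun i => y i ω) (fun i => x i ω) (βhat ω)) {T : ℝ} (hT : 0 < T) :
    P {ω | ENNReal.ofReal ((√hi * √(64 * T * (C * hi) / lo ^ 2 + 8 * T / lo) + 1) *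
        (√(k / n) + c)) < eLpNorm (seriesFn p (βhat ω) - g) 2 F} ≤
      ENNReal.ofReal (k * Real.exp (-(n * lo / (4 * xiSup X p ^ 2)))) +
        (ENNReal.ofReal T⁻¹ + ENNReal.ofReal T⁻¹) := by
  have := h.isProbabilityMeasure_law ⟨0, hn⟩
  have hK := h.ae_norm_le ⟨0, hn⟩ hp hb
  have hg2 := h.memLp_of_approxBound ⟨0, hn⟩ hp hb hg hgG hA
  have hproj := h.isProjCoef_of_isLSParam ⟨0, hn⟩ hp hb hg hg2 hC hβ
  have hc := hA.1
  have hrc := (hA.2 g hgG β hproj).1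
  have hser : ∀ b, MemLp (seriesFn p b) 2 F := fun b =>
    (memLp_top_seriesFn hp hK b).mono_exponent le_top
  have hr : MemLp (g - seriesFn p β) 2 F := hg2.sub (hser β)
  have hrc2 := (hr.eLpNorm_two_le_ofReal_iff hc).1 hrc
  have hgram := h.measure_gram_lt_le hn hp hb hE hlo
  have hn0 : (0 : ℝ) < n := by exact_mod_cast hn
  obtain ⟨hW1, hW2⟩ := h.integral_norm_sum_err_le hp hb hg hC
  have hW3 : ∫ ω, ‖∑ i, regErr y x g i ω • p (x i ω)‖ ^ 2 ∂P ≤ n * (C * (k * hi)) :=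
    hW2.trans (by gcongr; exact (hE.integral_norm_sq_mem hp hK).2)
  have hWtail := measure_mul_lt_le hW1 (fun ω => by positivity) hW3 hT
  have hrP : ∀ i, MemLp (fun ω => g (x i ω) - seriesFn p β (x i ω)) 2 P := fun i =>
    hr.comp_measurePreserving (h.measurePreserving i)
  have hR1 : Integrable (fun ω => ∑ i, (g (x i ω) - seriesFn p β (x i ω)) ^ 2) P :=
    integrable_finsetSum _ fun i _ => (hrP i).integrable_sq
  have hR2 : ∫ ω, ∑ i, (g (x i ω) - seriesFn p β (x i ω)) ^ 2 ∂P ≤ n * c ^ 2 := by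
    rw [integral_finsetSum _ fun i _ => (hrP i).integrable_sq]
    have : ∀ i, ∫ ω, (g (x i ω) - seriesFn p β (x i ω)) ^ 2 ∂P ≤ c ^ 2 := fun i => by
      refine le_trans (le_of_eq ?_) hrc2
      have hm : Measurable fun z => (g - seriesFn p β) z ^ 2 :=
        (hg.sub (measurable_seriesFn hp β)).pow_const 2
      rw [← h.law i, integral_map (h.measurable_x i).aemeasurable hm.aestronglyMeasurable]
      rfl
    simpa using Finset.sum_le_sum fun i (_ : i ∈ Finset.univ) => this i
  have hRtail := measure_mul_lt_le hR1 (fun ω => by positivity) hR2 hT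
  -- The bad event is covered by three events that do not involve `βhat`, so no measurability of the
  -- estimator is required.
  refine (measure_mono fun ω hω => ?_).trans ((measure_union_le _ _).trans
    (add_le_add hgram ((measure_union_le _ _).trans (add_le_add hWtail hRtail))))
  by_contra hcon
  simp only [Set.mem_union, Set.mem_ofPred_eq, not_or, not_exists, not_lt] at hcon hω
  obtain ⟨hgood, hWω, hRω⟩ := hcon
  refine hω.not_ge ?_
  have hdet := (hβhat ω).norm_sub_sq_le_add hn β g hlo hgood
  set M := √(64 * T * (C * hi) / lo ^ 2 + 8 * T / lo) with hM
  set s := √((k : ℝ) / n) with hs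
  have hs2 : s ^ 2 = k / n := Real.sq_sqrt (by positivity)
  have hM2 : M ^ 2 = 64 * T * (C * hi) / lo ^ 2 + 8 * T / lo := Real.sq_sqrt (by positivity)
  have hs0 : 0 ≤ s := Real.sqrt_nonneg _
  have hM0 : 0 ≤ M := Real.sqrt_nonneg _
  have hΔ : ‖βhat ω - β‖ ≤ M * (s + c) := by
    refine abs_le_of_sq_le_sq' (hdet.trans ?_) (by positivity) |>.2
    calc _ ≤ 64 / (n * lo) ^ 2 * (T * (n * (C * (k * hi)))) + 8 / (n * lo) * (T * (n * c ^ 2)) := by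
          gcongr
          exact hWω
      _ = 64 * T * (C * hi) / lo ^ 2 * s ^ 2 + 8 * T / lo * c ^ 2 := by
          rw [hs2]; field_simp
      _ ≤ (64 * T * (C * hi) / lo ^ 2 + 8 * T / lo) * (s + c) ^ 2 := by
          have h1 : 0 ≤ 64 * T * (C * hi) / lo ^ 2 := by positivity
          have h2 : 0 ≤ 8 * T / lo := by positivity
          have h3 : s ^ 2 ≤ (s + c) ^ 2 := by gcongr; linarith
          have h4 : c ^ 2 ≤ (s + c) ^ 2 := by gcongr; linarith
          rw [add_mul]
          gcongr
      _ = (M * (s + c)) ^ 2 := by rw [mul_pow, hM2]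
  have e : seriesFn p (βhat ω) - g = seriesFn p (βhat ω - β) - (g - seriesFn p β) := by
    funext z
    simp only [Pi.sub_apply, seriesFn, inner_sub_right]
    ring
  rw [e]
  refine (eLpNorm_sub_le (measurable_seriesFn hp _).aestronglyMeasurable
    (hg.sub (measurable_seriesFn hp _)).aestronglyMeasurable one_le_two).trans ?_
  refine (add_le_add (eLpNorm_seriesFn_le hp hK hE hhi _) hrc).trans ?_
  rw [← ENNReal.ofReal_add (by positivity) hc]
  refine ENNReal.ofReal_le_ofReal ?_
  have := mul_le_mul_of_nonneg_left hΔ (Real.sqrt_nonneg hi)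
  linarith

theorem integral_norm_sq_mul_sq_le [IsProbabilityMeasure F] (hp : Measurable p)
    (hK : ∀ᵐ z ∂F, ‖p z‖ ≤ xiSup X p) (hn : 0 < n) (hE : EigenvaluesIn F p lo hi) (hhi : 1 ≤ hi)
    {r : EuclideanSpace ℝ (Fin d) → ℝ} (hr : MemLp r 2 F) (hrc : ∫ z, r z ^ 2 ∂F ≤ c ^ 2)
    (hrl : ∀ᵐ z ∂F, |r z| ≤ l * c) :
    ∫ z, ‖p z‖ ^ 2 * r z ^ 2 ∂F ≤
      n * hi * (min (l * c * √(k / n)) (xiSup X p * c / √n)) ^ 2 := by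
  have hn0 : (0 : ℝ) < n := by exact_mod_cast hn
  rcases min_choice (l * c * √(k / n)) (xiSup X p * c / √n) with hm | hm
  · have hpi : Integrable (fun z => ‖p z‖ ^ 2) F := by
      refine Integrable.of_bound (hp.norm.pow_const 2).aestronglyMeasurable (xiSup X p ^ 2) ?_
      filter_upwards [hK] with z hz
      simp only [norm_pow, norm_norm]
      gcongr
    calc ∫ z, ‖p z‖ ^ 2 * r z ^ 2 ∂F ≤ ∫ z, ‖p z‖ ^ 2 * (l * c) ^ 2 ∂F := by
          refine integral_mono_of_nonneg (ae_of_all _ fun z => by positivity)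
            (hpi.mul_const _) ?_
          filter_upwards [hrl] with z hz
          have : r z ^ 2 ≤ (l * c) ^ 2 := by
            rw [← sq_abs (r z)]
            gcongr
          gcongr
      _ ≤ k * hi * (l * c) ^ 2 := by
          rw [integral_mul_const]
          gcongr
          exact (hE.integral_norm_sq_mem hp hK).2
      _ = _ := by
          rw [hm, mul_pow (l * c), Real.sq_sqrt (by positivity)]
          field_simp
  · calc ∫ z, ‖p z‖ ^ 2 * r z ^ 2 ∂F ≤ ∫ z, xiSup X p ^ 2 * r z ^ 2 ∂F := by
          refine integral_mono_of_nonneg (ae_of_all _ fun z => by positivity)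
            (hr.integrable_sq.const_mul _) ?_
          filter_upwards [hK] with z hz
          gcongr
      _ ≤ xiSup X p ^ 2 * c ^ 2 := by
          rw [integral_const_mul]
          gcongr
      -- The factor `hi ≥ 1` is inserted only so that both branches of the minimum share one form.
      _ ≤ hi * (xiSup X p ^ 2 * c ^ 2) := le_mul_of_one_le_left (by positivity) hhi
      _ = _ := by
          rw [hm, div_pow, mul_pow, Real.sq_sqrt hn0.le]
          field_simp

theorem measure_misspec_tail_le (h : IsRegressionSample P X F g y x) (hn : 0 < n)
    (hp : Measurable p) (hb : BddAbove ((fun z => ‖p z‖) '' X)) (hg : Measurable g) (hgG : g ∈ G)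
    (hE : EigenvaluesIn F p lo hi) (hlo : 0 < lo) (hhi : 1 ≤ hi) (hA : ApproxBound X F p G c l)
    (hC : CondVarLE P g y x C) (hC0 : 0 ≤ C) (hβ : IsLSParam P p y x β)
    (hβhat : ∀ ω, IsLSEstimate p (fun i => y i ω) (fun i => x i ω) (βhat ω)) {T : ℝ} (hT : 0 < T) :
    P {ω | ENNReal.ofReal ((√hi * √(32 * T * (C + 1) * hi / lo ^ 2) + 1) *
        (√(k / n) + min (l * c * √(k / n)) (xiSup X p * c / √n))) <
          eLpNorm (seriesFn p (βhat ω) - seriesFn p β) 2 F} ≤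
      ENNReal.ofReal (k * Real.exp (-(n * lo / (4 * xiSup X p ^ 2)))) + ENNReal.ofReal T⁻¹ := by
  have := h.isProbabilityMeasure_law ⟨0, hn⟩
  have hK := h.ae_norm_le ⟨0, hn⟩ hp hb
  have hg2 := h.memLp_of_approxBound ⟨0, hn⟩ hp hb hg hgG hA
  have hproj := h.isProjCoef_of_isLSParam ⟨0, hn⟩ hp hb hg hg2 hC hβ
  have hc := hA.1
  obtain ⟨hrc, hrl⟩ := hA.2 g hgG β hproj
  have hr : MemLp (g - seriesFn p β) 2 F :=
    hg2.sub ((memLp_top_seriesFn hp hK β).mono_exponent le_top)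
  have hrm : Measurable fun z => g z - seriesFn p β z := hg.sub (measurable_seriesFn hp β)
  have hrl' : ∀ᵐ z ∂F, |g z - seriesFn p β z| ≤ l * c :=
    h.ae_of_forall_mem ⟨0, hn⟩ (measurableSet_le hrm.abs measurable_const) hrl
  -- The sign of `l` is not given; `F` is a probability measure, so the bound on `|r|` holds at some
  -- point.
  have hlc : 0 ≤ l * c := by
    obtain ⟨z, hz⟩ := hrl'.exists
    exact (abs_nonneg _).trans hz
  have hgram := h.measure_gram_lt_le hn hp hb hE hlo
  have hn0 : (0 : ℝ) < n := by exact_mod_cast hn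
  have hD := integral_norm_sq_mul_sq_le (r := g - seriesFn p β) hp hK hn hE hhi hr
    ((hr.eLpNorm_two_le_ofReal_iff hc).1 hrc) hrl'
  have hmin0 : 0 ≤ min (l * c * √(k / n)) (xiSup X p * c / √n) :=
    le_min (by positivity) (div_nonneg (mul_nonneg xiSup_nonneg hc) (Real.sqrt_nonneg _))
  set q := min (l * c * √(k / n)) (xiSup X p * c / √n)
  obtain ⟨hW1, hW2⟩ := h.integral_norm_sum_resid_le hp hb hg hg2 hC hβ hD
  have hW3 : ∫ ω, ‖∑ i, (y i ω - seriesFn p β (x i ω)) • p (x i ω)‖ ^ 2 ∂P ≤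
      n * (2 * (C * (k * hi) + n * hi * q ^ 2)) :=
    hW2.trans (by gcongr; exact (hE.integral_norm_sq_mem hp hK).2)
  have hWtail := measure_mul_lt_le hW1 (fun ω => by positivity) hW3 hT
  refine (measure_mono fun ω hω => ?_).trans ((measure_union_le _ _).trans
    (add_le_add hgram hWtail))
  by_contra hcon
  simp only [Set.mem_union, Set.mem_ofPred_eq, not_or, not_exists, not_lt] at hcon hω
  obtain ⟨hgood, hWω⟩ := hcon
  refine hω.not_ge ?_
  have hdet := (hβhat ω).norm_sub_sq_le hn β hlo hgood
  set M := √(32 * T * (C + 1) * hi / lo ^ 2) with hM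
  set s := √((k : ℝ) / n) with hs
  have hs2 : s ^ 2 = k / n := Real.sq_sqrt (by positivity)
  have hM2 : M ^ 2 = 32 * T * (C + 1) * hi / lo ^ 2 := Real.sq_sqrt (by positivity)
  have hs0 : 0 ≤ s := Real.sqrt_nonneg _
  have hM0 : 0 ≤ M := Real.sqrt_nonneg _
  have hΔ : ‖βhat ω - β‖ ≤ M * (s + q) := by
    refine abs_le_of_sq_le_sq' (hdet.trans ?_) (by positivity) |>.2
    calc _ ≤ 16 / (n * lo) ^ 2 * (T * (n * (2 * (C * (k * hi) + n * hi * q ^ 2)))) := by gcongr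
      _ = 32 * T * hi / lo ^ 2 * (C * s ^ 2 + q ^ 2) := by
          rw [hs2]; field_simp; ring
      _ ≤ 32 * T * hi / lo ^ 2 * ((C + 1) * (s + q) ^ 2) := by
          gcongr
          nlinarith [mul_nonneg hs0 hmin0, mul_nonneg hC0 (mul_nonneg hs0 hmin0),
            mul_nonneg hC0 (sq_nonneg q), sq_nonneg s]
      _ = (M * (s + q)) ^ 2 := by rw [mul_pow, hM2]; ring
  have e : seriesFn p (βhat ω) - seriesFn p β = seriesFn p (βhat ω - β) := by
    funext z
    simp only [Pi.sub_apply, seriesFn, inner_sub_right]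
  rw [e]
  refine (eLpNorm_seriesFn_le hp hK hE (by linarith) _).trans (ENNReal.ofReal_le_ofReal ?_)
  have := mul_le_mul_of_nonneg_left hΔ (Real.sqrt_nonneg hi)
  nlinarith

end Tail

/-! ### Passage to the limit in `n`. -/

theorem eventually_mul_exp_le {k : ℕ → ℕ} {ξ : ℕ → ℝ} {lo : ℝ} (hlo : 0 < lo)
    (hk : ∀ n, 0 < n → k n * lo ≤ ξ n ^ 2)
    (hξ : Tendsto (fun n : ℕ => ξ n ^ 2 * Real.log n / n) atTop (𝓝 0)) {δ : ℝ} (hδ : 0 < δ) :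
    ∀ᶠ n : ℕ in atTop, k n * Real.exp (-(n * lo / (4 * ξ n ^ 2))) ≤ δ := by
  have hlog : Tendsto (fun n : ℕ => Real.log n) atTop atTop :=
    Real.tendsto_log_atTop.comp tendsto_natCast_atTop_atTop
  filter_upwards [eventually_gt_atTop 0, hlog.eventually_ge_atTop 1,
    hξ.eventually_lt_const (show (0 : ℝ) < lo / 8 by positivity),
    tendsto_inv_atTop_nhds_zero_nat.eventually_lt_const hδ] with n hn hlog1 hsmall hinv
  have hn0 : (0 : ℝ) < n := by exact_mod_cast hn
  rcases Nat.eq_zero_or_pos (k n) with h0 | h0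
  · simp [h0, hδ.le]
  have hk0 : (0 : ℝ) < k n := by exact_mod_cast h0
  have hkξ := hk n hn
  have hξ0 : 0 < ξ n ^ 2 := (mul_pos hk0 hlo).trans_le hkξ
  rw [div_lt_iff₀ hn0] at hsmall
  -- The threshold `lo / 8` is chosen to give exponent `2 log n`: one factor `1/n` cancels `k ≤ n`
  -- and the other tends to zero.
  have h1 : 2 * Real.log n ≤ n * lo / (4 * ξ n ^ 2) := by
    rw [le_div_iff₀ (by positivity)]
    linarith
  have h2 : (k n : ℝ) ≤ n := by
    refine le_of_mul_le_mul_right ?_ hlo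
    nlinarith
  calc k n * Real.exp (-(n * lo / (4 * ξ n ^ 2))) ≤ n * Real.exp (-(2 * Real.log n)) := by
        gcongr
    _ = (n : ℝ)⁻¹ := by
        rw [Real.exp_neg, two_mul, Real.exp_add, Real.exp_log hn0]
        field_simp
    _ ≤ δ := hinv.le

theorem EigenvaluesIn.mono_right {d k : ℕ} {F : Measure (EuclideanSpace ℝ (Fin d))}
    {p : EuclideanSpace ℝ (Fin d) → EuclideanSpace ℝ (Fin k)} {lo hi hi' : ℝ}
    (h : EigenvaluesIn F p lo hi) (hle : hi ≤ hi') : EigenvaluesIn F p lo hi' :=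
  fun t ht => ⟨(h t ht).1, (h t ht).2.trans hle⟩

theorem CondVarLE.mono {Ω : Type*} [MeasurableSpace Ω] {d n : ℕ} {P : Measure Ω}
    {g : EuclideanSpace ℝ (Fin d) → ℝ} {y : Fin n → Ω → ℝ}
    {x : Fin n → Ω → EuclideanSpace ℝ (Fin d)} {C C' : ℝ} (h : CondVarLE P g y x C)
    (hle : C ≤ C') : CondVarLE P g y x C' :=
  fun i => ⟨(h i).1, (h i).2.mono fun _ hω => hω.trans hle⟩

theorem mainTheorem1 {d : ℕ} {Ω : ℕ → Type*} [∀ n, MeasurableSpace (Ω n)]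
    (P : ∀ n, Measure (Ω n)) [∀ n, IsProbabilityMeasure (P n)]
    -- support set, covariate law, function class, regression function, sample
    (X : ℕ → Set (EuclideanSpace ℝ (Fin d)))
    (F : ℕ → Measure (EuclideanSpace ℝ (Fin d)))
    (G : ℕ → Set (EuclideanSpace ℝ (Fin d) → ℝ))
    (g : ℕ → EuclideanSpace ℝ (Fin d) → ℝ)
    (y : ∀ n, Fin n → Ω n → ℝ) (x : ∀ n, Fin n → Ω n → EuclideanSpace ℝ (Fin d))
    -- number of series terms, approximating functions, approximation constants
    (k : ℕ → ℕ) (p : ∀ n, EuclideanSpace ℝ (Fin d) → EuclideanSpace ℝ (Fin (k n)))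
    (c l : ℕ → ℝ)
    -- least squares parameter and least squares estimator
    (β : ∀ n, EuclideanSpace ℝ (Fin (k n))) (βhat : ∀ n, Ω n → EuclideanSpace ℝ (Fin (k n)))
    (hG : ∀ n, ∀ f ∈ G n, Measurable f)
    (hg : ∀ n, g n ∈ G n)
    (hp : ∀ n, Measurable (p n))
    (hp_bdd : ∀ n, BddAbove ((fun z => ‖p n z‖) '' X n))
    (hA1 : ∀ n, IsRegressionSample (P n) (X n) (F n) (g n) (y n) (x n))
    (hA2 : ∃ lo hi : ℝ, 0 < lo ∧ ∀ n, EigenvaluesIn (F n) (p n) lo hi)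
    (hA3 : ∀ n, ApproxBound (X n) (F n) (p n) (G n) (c n) (l n))
    (hξ : Tendsto (fun n : ℕ => xiSup (X n) (p n) ^ 2 * Real.log n / n) atTop (𝓝 0))
    (hσ : ∃ C : ℝ, ∀ n, CondVarLE (P n) (g n) (y n) (x n) C)
    (hβ : ∀ n, IsLSParam (P n) (p n) (y n) (x n) (β n))
    (hβhat : ∀ n ω, IsLSEstimate (p n) (fun i => y n i ω) (fun i => x n i ω) (βhat n ω)) :
    (Tendsto c atTop (𝓝 0) →
      IsBigOP P (fun n ω => eLpNorm (seriesFn (p n) (βhat n ω) - g n) 2 (F n))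
        (fun n => Real.sqrt (k n / n) + c n)) ∧
    (¬ Tendsto c atTop (𝓝 0) →
      IsBigOP P (fun n ω => eLpNorm (seriesFn (p n) (βhat n ω) - seriesFn (p n) (β n)) 2 (F n))
        (fun n => Real.sqrt (k n / n) +
          min (l n * c n * Real.sqrt (k n / n)) (xiSup (X n) (p n) * c n / Real.sqrt n))) := by
  obtain ⟨lo, hi₀, hlo, hE₀⟩ := hA2
  obtain ⟨C₀, hC₀⟩ := hσ
  set hi := max hi₀ 1
  set C := max C₀ 0
  have hhi : 1 ≤ hi := le_max_right _ _
  have hCnn : 0 ≤ C := le_max_right _ _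
  have hE : ∀ n, EigenvaluesIn (F n) (p n) lo hi := fun n => (hE₀ n).mono_right (le_max_left _ _)
  have hC : ∀ n, CondVarLE (P n) (g n) (y n) (x n) C := fun n => (hC₀ n).mono (le_max_left _ _)
  have hgm : ∀ n, Measurable (g n) := fun n => hG n _ (hg n)
  have hsmall : ∀ δ : ℝ, 0 < δ → ∀ᶠ n : ℕ in atTop,
      k n * Real.exp (-(n * lo / (4 * xiSup (X n) (p n) ^ 2))) ≤ δ := fun δ hδ =>
    eventually_mul_exp_le hlo
      (fun n hn => (hA1 n).card_mul_le_xiSup_sq hn (hp n) (hp_bdd n) (hE n)) hξ hδ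
  constructor
  · intro _ δ hδ
    -- `T = 3 / δ` gives each of the three bad events probability at most `δ / 3`.
    refine ⟨√hi * √(64 * (3 / δ) * (C * hi) / lo ^ 2 + 8 * (3 / δ) / lo) + 1, by positivity, ?_⟩
    filter_upwards [eventually_gt_atTop 0, hsmall (δ / 3) (by positivity)] with n hn hexp
    refine (measure_correct_tail_le (hA1 n) hn (hp n) (hp_bdd n) (hgm n) (hg n) (hE n) hlo
      (zero_le_one.trans hhi) (hA3 n) (hC n) hCnn (hβ n) (hβhat n)
      (T := 3 / δ) (by positivity)).trans ?_
    rw [← ENNReal.ofReal_add (by positivity) (by positivity),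
      ← ENNReal.ofReal_add (by positivity) (by positivity), inv_div]
    exact ENNReal.ofReal_le_ofReal (by linarith)
  · intro _ δ hδ
    refine ⟨√hi * √(32 * (2 / δ) * (C + 1) * hi / lo ^ 2) + 1, by positivity, ?_⟩
    filter_upwards [eventually_gt_atTop 0, hsmall (δ / 2) (by positivity)] with n hn hexp
    refine (measure_misspec_tail_le (hA1 n) hn (hp n) (hp_bdd n) (hgm n) (hg n) (hE n) hlo
      hhi (hA3 n) (hC n) hCnn (hβ n) (hβhat n)
      (T := 2 / δ) (by positivity)).trans ?_
    rw [← ENNReal.ofReal_add (by positivity) (by positivity), inv_div]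
    exact ENNReal.ofReal_le_ofReal (by linarith)
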